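/- Let $p$ be a prime and let $G$ be an (additively written) abelian $p$-group; write $pG=\{px : x\in G\}$. Call an abelian group $A$ \emph{generalized co-Bassian} if, for every subgroup $H\le A$ and every injective homomorphism $\varphi:A\to A/H$, the image $\varphi(A)$ is a direct summand of $A/H$; call $A$ \emph{semi-generalized co-Bassian} if, for every subgroup $H\le A$ and every injective homomorphism $\varphi:A\to A/H$, the image $\varphi(A)$ is essential in some direct summand $S$ of $A/H$ (that is, $\varphi(A)\le S$ and $\varphi(A)$ meets every non-zero subgroup of $S$ non-trivially). Say that an abelian $p$-group $A$ has \emph{generalized finite $p$-rank} if $$A\cong \mathbb Z_{p^{\sigma_1}}^{(\rho_1)}\oplus\cdots\oplus \mathbb Z_{p^{\sigma_n}}^{(\rho_n)}$$ for some $n\ge 0$, some $\sigma_1<\cdots<\sigma_n$ in $\mathbb N\cup\{\infty\}$ and some cardinals $\rho_1,\dots,\rho_n$ with $\rho_j$ finite whenever $j>1$; here $\mathbb Z_{p^{k}}$ is the cyclic group of order $p^k$, $\mathbb Z_{p^\infty}$ is the Prüfer group, and $B^{(\rho)}$ is the direct sum of $\rho$ copies of $B$. Then $G$ is semi-generalized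 co-Bassian if and only if $pG$ is generalized co-Bassian. Moreover, $pG$ is generalized co-Bassian if and only if $pG$ has generalized finite $p$-rank. -/

import Mathlib

/-- A subgroup `A` of an abelian group is a direct summand if it has a complement. -/
def IsDirectSummand {G : Type*} [AddCommGroup G] (A : AddSubgroup G) : Prop :=
  ∃ B : AddSubgroup G, IsCompl A B

/-- The subgroup `A` is contained in the subgroup `S` and is essential in it: it meets every
non-zero subgroup of `S` non-trivially. -/
def IsEssentialIn {G : Type*} [AddCommGroup G] (A S : AddSubgroup G) : Prop :=
  A ≤ S ∧ ∀ X : AddSubgroup G, X ≤ S → X ≠ ⊥ → A ⊓ X ≠ ⊥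

/-- `G` is generalized co-Bassian: the image of any injective homomorphism of `G` into one of its
quotients `G ⧸ H` is a direct summand of `G ⧸ H`. -/
def IsGeneralizedCoBassian (G : Type*) [AddCommGroup G] : Prop :=
  ∀ (H : AddSubgroup G) (φ : G →+ G ⧸ H), Function.Injective φ → IsDirectSummand φ.range

/-- `G` is semi-generalized co-Bassian: the image of any injective homomorphism of `G` into one of
its quotients `G ⧸ H` is essential in a direct summand of `G ⧸ H`. -/
def IsSemiGeneralizedCoBassian (G : Type*) [AddCommGroup G] : Prop :=
  ∀ (H : AddSubgroup G) (φ : G →+ G ⧸ H), Function.Injective φ →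
    ∃ S : AddSubgroup (G ⧸ H), IsDirectSummand S ∧ IsEssentialIn φ.range S

/-- The subgroup `pG = {p • x : x ∈ G}` of `G`. -/
def pMultiples (p : ℕ) (G : Type*) [AddCommGroup G] : AddSubgroup G :=
  (nsmulAddMonoidHom p : G →+ G).range

/-- The cocyclic `p`-group `ℤ_{p^σ}`, for `σ` a natural number or `∞`, realised inside `ℚ/ℤ`:
for finite `σ` the `p^σ`-torsion subgroup, which is cyclic of order `p^σ`; for `σ = ∞` the
`p`-primary component, which is the Prüfer group `ℤ(p^∞)`. -/
def cocyclicGroup (p : ℕ) (σ : ℕ∞) : AddSubgroup (AddCircle (1 : ℚ)) where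
  carrier := {x | ∃ k : ℕ, (k : ℕ∞) ≤ σ ∧ p ^ k • x = 0}
  zero_mem' := ⟨0, by simp, by simp⟩
  neg_mem' := by
    rintro x ⟨k, hk, hx⟩
    exact ⟨k, hk, by rw [smul_neg, hx, neg_zero]⟩
  add_mem' := by
    rintro x y ⟨k, hk, hx⟩ ⟨l, hl, hy⟩
    refine ⟨max k l, by rcases max_choice k l with h | h <;> rw [h] <;> assumption, ?_⟩
    obtain ⟨a, ha⟩ := pow_dvd_pow p (le_max_left k l)
    obtain ⟨b, hb⟩ := pow_dvd_pow p (le_max_right k l)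
    rw [smul_add]
    nth_rewrite 1 [ha]
    rw [hb, mul_comm _ a, mul_comm _ b, mul_smul, mul_smul, hx, hy, smul_zero, smul_zero, add_zero]

/-- `A` has generalized finite `p`-rank: it is isomorphic to a finite direct sum
`ℤ_{p^σ₁}^(ρ₁) ⊕ ⋯ ⊕ ℤ_{p^σₙ}^(ρₙ)` with `σ₁ < ⋯ < σₙ` in `ℕ ∪ {∞}`, where `ρⱼ` is finite
for every `j` other than the first. The cardinal `ρⱼ` is given by an index type `ι j`, finitely
supported functions on `ι j` form the direct sum of `ρⱼ` copies, and the finite direct sum over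
`j` is written as a product. -/
def HasGeneralizedFinitePRank.{u} (p : ℕ) (A : Type u) [AddCommGroup A] : Prop :=
  ∃ (n : ℕ) (σ : Fin n → ℕ∞) (ι : Fin n → Type u),
    StrictMono σ ∧ (∀ j : Fin n, 0 < (j : ℕ) → Finite (ι j)) ∧
      Nonempty (A ≃+ ((j : Fin n) → (ι j →₀ cocyclicGroup p (σ j))))

/-! Everything passes through the notion `IsNearlyHomogeneous`: either the group is divisible, or
for some m every element of the socle has height at least m and only finitely many have height above
m. All three conditions of the theorem are equivalent to `pMultiples p G` being nearly homogeneous.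

For generalized finite p-rank, homocyclic summands are split off height by height. Finiteness of the
upper socle makes its height filtration stabilise, so a divisible remainder ends the process, and it
also bounds the ranks of all summands but the first.

If A is nearly homogeneous and φ embeds A in a quotient X, then in the bounded-height case counting
(`surjective_of_finite_socle`) shows that φ maps p^(m+1)A onto p^(m+1)X, and a Zorn argument splits
off φ(A). A divisible image splits off directly.

Conversely, suppose w in the socle has exact height k while infinitely many socle elements are
higher. Then A = Z ⊕ M with Z cyclic of order p^(k+1) and socle generated by w. The group M is so
large that some quotient of A has room for an embedding φ that raises the height of w
(`exists_height_increasing_embedding`). A summand preserves heights, so φ(A) is not one. When w has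
height at least 1, φ(A) is not even essential in a summand. Height 0 is harmless in the
semi-generalized case, which is why the condition falls on pG.

If pG is nearly homogeneous, write G = E ⊕ G' with pE = 0 and the socle of G' inside pG'. Then G' is
nearly homogeneous, so X = φ(G') ⊕ C, and φ(G) ∩ C is killed by p. Some p^j C is divisible, so
`isSocleOfSummand` makes this intersection the socle of a summand S of C. Then φ(G) is essential in
φ(G') ⊕ S. -/

/-- Every element of `A` is killed by a power of `p`. -/
def IsPPrimary (p : ℕ) (A : Type*) [AddCommGroup A] : Prop :=
  ∀ x : A, ∃ n : ℕ, p ^ n • x = 0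

/-- Multiplication by `p` is surjective on `A`. -/
def IsPDivisible (p : ℕ) (A : Type*) [AddCommGroup A] : Prop :=
  ∀ x : A, ∃ y : A, p • y = x

/-- The elements of order dividing `p` and of height at least `i`. -/
def heightSocle (p i : ℕ) (A : Type*) [AddCommGroup A] : AddSubgroup A :=
  (nsmulAddMonoidHom p : A →+ A).ker ⊓ pMultiples (p ^ i) A

theorem mem_pMultiples {n : ℕ} {A : Type*} [AddCommGroup A] {x : A} :
    x ∈ pMultiples n A ↔ ∃ y : A, n • y = x := by
  simp [pMultiples]

theorem mem_heightSocle {p i : ℕ} {A : Type*} [AddCommGroup A] {x : A} :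
    x ∈ heightSocle p i A ↔ p • x = 0 ∧ ∃ y : A, p ^ i • y = x := by
  simp [heightSocle, mem_pMultiples]

theorem heightSocle_anti {p : ℕ} {A : Type*} [AddCommGroup A] {i j : ℕ} (h : i ≤ j) :
    heightSocle p j A ≤ heightSocle p i A := by
  intro x hx
  rw [mem_heightSocle] at hx ⊢
  obtain ⟨h1, y, rfl⟩ := hx
  refine ⟨h1, p ^ (j - i) • y, ?_⟩
  rw [smul_smul, ← pow_add, Nat.add_sub_cancel' h]

/-! ### Heights, complements by Zorn's lemma, and injectivity of divisible groups. -/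

section Basic

variable {p : ℕ} {A B : Type*} [AddCommGroup A] [AddCommGroup B]

theorem IsPPrimary.of_injective (hB : IsPPrimary p B) (f : A →+ B) (hf : Function.Injective f) :
    IsPPrimary p A := fun x => by
  obtain ⟨n, hn⟩ := hB (f x)
  exact ⟨n, hf (by rw [map_nsmul, hn, map_zero])⟩

theorem IsPPrimary.of_surjective (hA : IsPPrimary p A) (f : A →+ B)
    (hf : Function.Surjective f) : IsPPrimary p B := fun x => by
  obtain ⟨a, rfl⟩ := hf x
  obtain ⟨n, hn⟩ := hA a
  exact ⟨n, by rw [← map_nsmul, hn, map_zero]⟩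

theorem IsPPrimary.addSubgroup (hA : IsPPrimary p A) (S : AddSubgroup A) : IsPPrimary p S :=
  hA.of_injective S.subtype S.subtype_injective

theorem IsPDivisible.of_surjective (hA : IsPDivisible p A) (f : A →+ B)
    (hf : Function.Surjective f) : IsPDivisible p B := fun x => by
  obtain ⟨a, rfl⟩ := hf x
  obtain ⟨b, rfl⟩ := hA a
  exact ⟨f b, by rw [map_nsmul]⟩

theorem IsPDivisible.pow (hA : IsPDivisible p A) (n : ℕ) (x : A) : ∃ y : A, p ^ n • y = x := by
  induction n with
  | zero => exact ⟨x, by simp⟩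
  | succ n ih =>
    obtain ⟨y, rfl⟩ := ih
    obtain ⟨z, rfl⟩ := hA y
    exact ⟨z, by rw [pow_succ, mul_smul]⟩

/-- Some multiple `p ^ r • x` is the last one before the powers of `p` bring `x` into `S`. -/
theorem IsPPrimary.exists_pow_notMem (hA : IsPPrimary p A) (S : AddSubgroup A) {x : A}
    (hx : x ∉ S) : ∃ r : ℕ, p ^ r • x ∉ S ∧ p • (p ^ r • x) ∈ S := by
  classical
  have h : ∃ n : ℕ, p ^ n • x ∈ S := by
    obtain ⟨n, hn⟩ := hA x
    exact ⟨n, by rw [hn]; exact S.zero_mem⟩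
  obtain ⟨m, hm⟩ : ∃ m, Nat.find h = m + 1 := by
    refine Nat.exists_eq_succ_of_ne_zero fun h0 => hx ?_
    have := Nat.find_spec h
    rwa [h0, pow_zero, one_smul] at this
  refine ⟨m, Nat.find_min h (by omega), ?_⟩
  have := Nat.find_spec h
  rwa [hm, pow_succ', mul_smul] at this

theorem IsPPrimary.exists_pow_ne_zero (hA : IsPPrimary p A) {x : A} (hx : x ≠ 0) :
    ∃ r : ℕ, p ^ r • x ≠ 0 ∧ p • (p ^ r • x) = 0 := by
  simpa using hA.exists_pow_notMem ⊥ (x := x) (by simpa using hx)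

theorem IsPPrimary.injective_of_socle (hA : IsPPrimary p A) (f : A →+ B)
    (h : ∀ x : A, p • x = 0 → f x = 0 → x = 0) : Function.Injective f := by
  rw [injective_iff_map_eq_zero]
  intro x hx
  by_contra hne
  obtain ⟨r, hr, hr'⟩ := hA.exists_pow_ne_zero hne
  exact hr (h _ hr' (by rw [map_nsmul, hx, smul_zero]))

theorem mem_of_zsmul_mem (hp : p.Prime) (S : AddSubgroup A) {x : A} {n : ℤ} (hn : ¬ (p : ℤ) ∣ n)
    (h1 : p • x ∈ S) (h2 : n • x ∈ S) : x ∈ S := by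
  have hc : IsCoprime (p : ℤ) n :=
    (Nat.prime_iff_prime_int.mp hp).irreducible.coprime_iff_not_dvd.mpr hn
  obtain ⟨a, b, hab⟩ := hc
  have : x = a • (p • x) + b • (n • x) := by
    rw [← natCast_zsmul x p, smul_smul, smul_smul, ← add_smul, hab, one_smul]
  rw [this]
  exact S.add_mem (S.zsmul_mem h1 _) (S.zsmul_mem h2 _)

/-- Since p^i x lies in the socle, it equals p^m y. Subtracting p^j y from x lowers the exponent of
the order by one, and induction gives one more factor p than needed. -/
theorem exists_pow_smul_of_socle {m : ℕ} (h : ∀ x : A, p • x = 0 → ∃ y : A, p ^ m • y = x)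
    (i : ℕ) : ∀ j, i + j = m + 1 → ∀ x : A, p ^ i • x = 0 → ∃ y : A, p ^ j • y = x := by
  induction i with
  | zero =>
    intro j _ x hx
    exact ⟨0, by simpa using hx.symm⟩
  | succ i ih =>
    intro j hij x hx
    obtain ⟨y, hy⟩ := h (p ^ i • x) (by rw [smul_smul, ← pow_succ', hx])
    obtain ⟨z, hz⟩ := ih (j + 1) (by omega) (x - p ^ j • y) (by
      rw [smul_sub, smul_smul, ← pow_add, ← hy, show i + j = m by omega, sub_self])
    refine ⟨p • z + y, ?_⟩
    rw [smul_add, smul_smul, ← pow_succ, hz, sub_add_cancel]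

theorem exists_smul_of_socle {m : ℕ} (h : ∀ x : A, p • x = 0 → ∃ y : A, p ^ m • y = x)
    (x : A) (hx : p ^ m • x = 0) : ∃ y : A, p • y = x := by
  simpa using exists_pow_smul_of_socle h m 1 rfl x hx

theorem IsPPrimary.isPDivisible_of_socle (hA : IsPPrimary p A)
    (h : ∀ x : A, p • x = 0 → ∀ i : ℕ, ∃ y : A, p ^ i • y = x) : IsPDivisible p A := fun x => by
  obtain ⟨n, hn⟩ := hA x
  exact exists_smul_of_socle (fun z hz => h z hz n) x hn

/-- A subgroup has a complement above `C₀` if no subgroup disjoint from it forces division by `p`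
outside of it. -/
theorem exists_isCompl_of_smul_mem (hp : p.Prime) (hA : IsPPrimary p A) (Y C₀ : AddSubgroup A)
    (h0 : Disjoint Y C₀)
    (h : ∀ C : AddSubgroup A, C₀ ≤ C → Disjoint Y C → ∀ a y c : A, y ∈ Y → c ∈ C →
      p • a = y + c → ∃ z ∈ Y, p • z = y) :
    ∃ C, C₀ ≤ C ∧ IsCompl Y C := by
  obtain ⟨C, hC0, hC⟩ := zorn_le_nonempty₀ {C : AddSubgroup A | Disjoint Y C} (by
    intro c hc hchain y hy
    refine ⟨sSup c, ?_, fun z hz => le_sSup hz⟩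
    rw [Set.mem_ofPred_eq, AddSubgroup.disjoint_def]
    intro x hxY hx
    rw [AddSubgroup.mem_sSup_of_directedOn ⟨y, hy⟩ hchain.directedOn] at hx
    obtain ⟨s, hs, hxs⟩ := hx
    exact AddSubgroup.disjoint_def.mp (hc hs) hxY hxs) C₀ h0
  refine ⟨C, hC0, hC.1, codisjoint_iff.mpr ?_⟩
  have hdisj : Disjoint Y C := hC.1
  by_contra hne
  obtain ⟨a, ha⟩ : ∃ a, a ∉ Y ⊔ C := by
    by_contra hall
    push Not at hall
    exact hne (top_unique fun x _ => hall x)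
  obtain ⟨r, hr, hr'⟩ := hA.exists_pow_notMem _ ha
  obtain ⟨y, hy, c, hc, hyc⟩ := AddSubgroup.mem_sup.mp hr'
  obtain ⟨z, hz, rfl⟩ := h C hC0 hdisj _ y c hy hc hyc.symm
  -- The correction by z puts p b in C while b stays outside Y + C. Hence C + ⟨b⟩ is still disjoint
  -- from Y, against the maximality of C.
  set b : A := p ^ r • a - z with hb
  have hbC : p • b ∈ C := by rw [hb, smul_sub, ← hyc, add_sub_cancel_left]; exact hc
  have hbn : b ∉ Y ⊔ C := fun hbm => hr (by
    rw [show p ^ r • a = b + z by rw [hb, sub_add_cancel]]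
    exact add_mem hbm (AddSubgroup.mem_sup_left hz))
  have hd : Disjoint Y (C ⊔ AddSubgroup.zmultiples b) := by
    rw [AddSubgroup.disjoint_def]
    intro x hxY hx
    obtain ⟨c', hc', w, hw, rfl⟩ := AddSubgroup.mem_sup.mp hx
    obtain ⟨n, rfl⟩ := AddSubgroup.mem_zmultiples_iff.mp hw
    have hpn : (p : ℤ) ∣ n := by
      by_contra hpn
      refine hbn (mem_of_zsmul_mem hp _ hpn (AddSubgroup.mem_sup_right hbC) ?_)
      rw [show n • b = (c' + n • b) - c' by abel]
      exact sub_mem (AddSubgroup.mem_sup_left hxY) (AddSubgroup.mem_sup_right hc')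
    obtain ⟨k, rfl⟩ := hpn
    refine AddSubgroup.disjoint_def.mp hdisj hxY (add_mem hc' ?_)
    rw [mul_comm, mul_smul, natCast_zsmul]
    exact C.zsmul_mem hbC _
  have hle := hC.2 hd le_sup_left
  exact hbn (AddSubgroup.mem_sup_right (hle (AddSubgroup.mem_sup_right
    (AddSubgroup.mem_zmultiples b))))

theorem IsPDivisible.exists_isCompl (hp : p.Prime) (hA : IsPPrimary p A) {Y : AddSubgroup A}
    (hY : IsPDivisible p Y) : ∃ C, IsCompl Y C := by
  obtain ⟨C, -, hC⟩ := exists_isCompl_of_smul_mem hp hA Y ⊥ disjoint_bot_right (by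
    intro C _ _ a y c hy _ _
    obtain ⟨z, hz⟩ := hY ⟨y, hy⟩
    exact ⟨z, z.2, congrArg Subtype.val hz⟩)
  exact ⟨C, hC⟩

/-- A homogeneous subgroup of exponent `p ^ (m + 1)` meeting `p ^ (m + 1) A` trivially has a
complement containing `p ^ (m + 1) A`. -/
theorem exists_isCompl_of_disjoint_pMultiples (hp : p.Prime) (hA : IsPPrimary p A)
    {Y : AddSubgroup A} {m : ℕ} (hY : ∀ x : Y, p • x = 0 → ∃ y : Y, p ^ m • y = x)
    (hd : Disjoint Y (pMultiples (p ^ (m + 1)) A)) :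
    ∃ C, pMultiples (p ^ (m + 1)) A ≤ C ∧ IsCompl Y C := by
  refine exists_isCompl_of_smul_mem hp hA Y _ hd ?_
  intro C hC hYC a y c hy hc hayc
  -- The element p^m y is p^(m+1) a minus an element of C, and C contains p^(m+1) A, so it lies in Y
  -- ∩ C.
  have h1 : p ^ m • y = 0 := by
    refine AddSubgroup.disjoint_def.mp hYC (Y.nsmul_mem hy _) ?_
    have : p ^ m • y = p ^ (m + 1) • a - p ^ m • c := by
      rw [pow_succ, mul_smul, hayc, smul_add, add_sub_cancel_right]
    rw [this]
    exact sub_mem (hC (mem_pMultiples.mpr ⟨a, rfl⟩)) (C.nsmul_mem hc _)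
  obtain ⟨z, hz⟩ := exists_smul_of_socle hY ⟨y, hy⟩ (Subtype.ext h1)
  exact ⟨z, z.2, congrArg Subtype.val hz⟩

/-- A homogeneous subgroup `Y` with `p ^ (m + 1) Y = p ^ (m + 1) A` is a direct summand. -/
theorem exists_isCompl_of_pMultiples_le (hp : p.Prime) (hA : IsPPrimary p A)
    {Y : AddSubgroup A} {m : ℕ} (hY : ∀ x : Y, p • x = 0 → ∃ y : Y, p ^ m • y = x)
    (hd : ∀ a : A, ∃ y ∈ Y, p ^ (m + 1) • y = p ^ (m + 1) • a) :
    ∃ C, IsCompl Y C := by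
  obtain ⟨C, -, hC⟩ := exists_isCompl_of_smul_mem hp hA Y ⊥ disjoint_bot_right (by
    intro C _ hYC a y c hy hc hayc
    obtain ⟨b, hb, hba⟩ := hd a
    -- Replacing a by a - b, with b in Y having the same p^(m+1)-multiple, reduces to the argument
    -- of the previous lemma.
    have h1 : p ^ m • (y - p • b) = 0 := by
      have h2 : p ^ m • (y - p • b) = - (p ^ m • c) := by
        have : p ^ m • (p • a) = p ^ m • (p • b) := by
          rw [smul_smul, smul_smul, ← pow_succ, hba]
        rw [smul_sub, ← this, hayc, smul_add]
        abel
      refine AddSubgroup.disjoint_def.mp hYC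
        (Y.nsmul_mem (sub_mem hy (Y.nsmul_mem hb _)) _) ?_
      rw [h2]
      exact neg_mem (C.nsmul_mem hc _)
    obtain ⟨z, hz⟩ := exists_smul_of_socle hY ⟨y - p • b, sub_mem hy (Y.nsmul_mem hb _)⟩
      (Subtype.ext h1)
    have hz' : p • (z : A) = y - p • b := congrArg Subtype.val hz
    exact ⟨z + b, add_mem z.2 hb, by rw [smul_add, hz', sub_add_cancel]⟩)
  exact ⟨C, hC⟩

/-- `p`-divisible `p`-primary groups are injective. -/
theorem IsPDivisible.baer (hp : p.Prime) (hA : IsPPrimary p A) (hd : IsPDivisible p A) :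
    Module.Baer ℤ A := by
  intro I g
  obtain ⟨n, rfl⟩ := (IsPrincipalIdealRing.principal I).principal
  have hn : n ∈ Submodule.span ℤ {n} := Submodule.mem_span_singleton_self n
  obtain ⟨t, ht⟩ : ∃ t : A, n • t = g ⟨n, hn⟩ := by
    by_cases h0 : n = 0
    · subst h0
      refine ⟨0, ?_⟩
      rw [smul_zero, show (⟨0, hn⟩ : Submodule.span ℤ {(0 : ℤ)}) = 0 from rfl, map_zero]
    · obtain ⟨a, u, hu, rfl⟩ : ∃ (a : ℕ) (u : ℤ), ¬ (p : ℤ) ∣ u ∧ n = p ^ a * u := by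
        have hf : FiniteMultiplicity (p : ℤ) n :=
          Int.finiteMultiplicity_iff.mpr ⟨by simpa using hp.ne_one, h0⟩
        obtain ⟨u, hu, hu'⟩ := hf.exists_eq_pow_mul_and_not_dvd
        exact ⟨_, u, hu', hu⟩
      obtain ⟨z, hz⟩ := hd.pow a (g ⟨_, hn⟩)
      obtain ⟨s, hs⟩ := hA z
      -- Division by p^a comes from divisibility. The factor u prime to p acts invertibly on z,
      -- which has p-power order, and w is its inverse modulo p^s.
      have hc : IsCoprime ((p : ℤ) ^ s) u :=
        ((Nat.prime_iff_prime_int.mp hp).irreducible.coprime_iff_not_dvd.mpr hu).pow_left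
      obtain ⟨v, w, hvw⟩ := hc
      refine ⟨w • z, ?_⟩
      rw [← hz, smul_smul, mul_assoc, mul_comm u w, show w * u = 1 - v * p ^ s by linarith,
        mul_sub, mul_one, sub_smul, ← mul_assoc, mul_smul (_ * v)]
      have : ((p : ℤ) ^ s) • z = 0 := by
        rw [← hs, ← natCast_zsmul]; push_cast; rfl
      rw [this, smul_zero, sub_zero, ← natCast_zsmul]
      push_cast
      rfl
  refine ⟨LinearMap.toSpanSingleton ℤ A t, ?_⟩
  intro x hx
  obtain ⟨k, rfl⟩ := Submodule.mem_span_singleton.mp hx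
  rw [show (⟨k • n, hx⟩ : Submodule.span ℤ {n}) = k • ⟨n, hn⟩ from rfl, map_smul g, ← ht,
    LinearMap.toSpanSingleton_apply, smul_eq_mul, mul_smul]

theorem exists_comp_eq_of_surjective {F M T : Type*} [AddCommGroup F] [AddCommGroup M]
    [AddCommGroup T] (y : F →+ M) (hy : Function.Surjective y) (d : F →+ T)
    (h : ∀ x, y x = 0 → d x = 0) : ∃ θ : M →+ T, ∀ x, θ (y x) = d x := by
  refine ⟨y.liftOfSurjective hy ⟨d, fun x hx => h x hx⟩, fun x => ?_⟩
  exact AddMonoidHom.liftOfRightInverse_comp_apply _ _ _ _ _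

/-- Extension of homomorphisms into a `p`-divisible `p`-primary group. -/
theorem IsPDivisible.exists_comp_eq (hp : p.Prime) {F M : Type*} [AddCommGroup F]
    [AddCommGroup M] (hA : IsPPrimary p A) (hd : IsPDivisible p A) (y : F →+ M) (d : F →+ A)
    (h : ∀ x, y x = 0 → d x = 0) : ∃ π : M →+ A, ∀ x, π (y x) = d x := by
  obtain ⟨θ, hθ⟩ := exists_comp_eq_of_surjective y.rangeRestrict y.rangeRestrict_surjective d
    (fun x hx => h x (congrArg Subtype.val hx))
  obtain ⟨π, hπ⟩ := (hd.baer hp hA).extension_property_addMonoidHom y.range.subtype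
    y.range.subtype_injective θ
  exact ⟨π, fun x => by rw [← hθ, ← hπ]; rfl⟩

end Basic

/-! ### Arithmetic of cyclic and Prüfer p-groups inside ℚ/ℤ. -/

section Cocyclic

variable {p : ℕ}

theorem zsmul_inv_pow_eq_zero_iff (hp : p.Prime) (k : ℕ) (n : ℤ) :
    n • (((p ^ k : ℚ)⁻¹ : ℚ) : AddCircle (1 : ℚ)) = 0 ↔ (p : ℤ) ^ k ∣ n := by
  have h0 : (p : ℚ) ^ k ≠ 0 := pow_ne_zero _ (Nat.cast_ne_zero.mpr hp.ne_zero)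
  rw [← AddCircle.coe_zsmul, AddCircle.coe_eq_zero_iff]
  constructor
  · rintro ⟨m, hm⟩
    refine ⟨m, ?_⟩
    rw [zsmul_eq_mul, zsmul_eq_mul, mul_one, eq_mul_inv_iff_mul_eq₀ h0] at hm
    rw [mul_comm]
    exact_mod_cast hm.symm
  · rintro ⟨m, rfl⟩
    refine ⟨m, ?_⟩
    rw [zsmul_eq_mul, zsmul_eq_mul, mul_one, eq_mul_inv_iff_mul_eq₀ h0]
    push_cast
    ring

theorem exists_zsmul_inv_pow (hp : p.Prime) (k : ℕ) (x : AddCircle (1 : ℚ))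
    (hx : p ^ k • x = 0) : ∃ n : ℤ, n • (((p ^ k : ℚ)⁻¹ : ℚ) : AddCircle (1 : ℚ)) = x := by
  have h0 : (p : ℚ) ^ k ≠ 0 := pow_ne_zero _ (Nat.cast_ne_zero.mpr hp.ne_zero)
  induction x using QuotientAddGroup.induction_on with
  | H q =>
  change p ^ k • ((q : ℚ) : AddCircle (1 : ℚ)) = 0 at hx
  rw [← AddCircle.coe_nsmul, AddCircle.coe_eq_zero_iff] at hx
  obtain ⟨n, hn⟩ := hx
  refine ⟨n, ?_⟩
  rw [← AddCircle.coe_zsmul]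
  congr 1
  rw [zsmul_eq_mul, mul_inv_eq_iff_eq_mul₀ h0]
  rw [zsmul_eq_mul, mul_one, nsmul_eq_mul] at hn
  rw [hn]
  push_cast
  ring

theorem pow_nsmul_inv_pow (hp : p.Prime) (i k : ℕ) :
    p ^ i • (((p ^ (i + k) : ℚ)⁻¹ : ℚ) : AddCircle (1 : ℚ)) =
      (((p ^ k : ℚ)⁻¹ : ℚ) : AddCircle (1 : ℚ)) := by
  have h0 : (p : ℚ) ≠ 0 := Nat.cast_ne_zero.mpr hp.ne_zero
  rw [← AddCircle.coe_nsmul]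
  congr 1
  rw [nsmul_eq_mul, pow_add]
  push_cast
  field_simp

/-- The element `1 / p ^ k` of `cocyclicGroup p σ`. -/
def cocyclicGen (hp : p.Prime) (σ : ℕ∞) (k : ℕ) (hk : (k : ℕ∞) ≤ σ) : cocyclicGroup p σ :=
  ⟨(((p ^ k : ℚ)⁻¹ : ℚ) : AddCircle (1 : ℚ)), k, hk, by
    simpa using pow_nsmul_inv_pow hp k 0 ▸ AddCircle.coe_eq_zero_iff (p := (1 : ℚ)) |>.mpr ⟨1, by simp⟩⟩

theorem zsmul_cocyclicGen (hp : p.Prime) {σ : ℕ∞} {k : ℕ} (hk : (k : ℕ∞) ≤ σ) (n : ℤ) :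
    n • cocyclicGen hp σ k hk = 0 ↔ (p : ℤ) ^ k ∣ n := by
  rw [← zsmul_inv_pow_eq_zero_iff hp, ← Subtype.coe_inj]
  rfl

theorem exists_zsmul_cocyclicGen (hp : p.Prime) {σ : ℕ∞} {k : ℕ} (hk : (k : ℕ∞) ≤ σ)
    (x : cocyclicGroup p σ) (hx : p ^ k • x = 0) : ∃ n : ℤ, n • cocyclicGen hp σ k hk = x := by
  obtain ⟨n, hn⟩ := exists_zsmul_inv_pow hp k x.1 (congrArg Subtype.val hx)
  exact ⟨n, Subtype.ext hn⟩

theorem pow_nsmul_cocyclicGen (hp : p.Prime) {σ : ℕ∞} {i k l : ℕ} (hl : (l : ℕ∞) ≤ σ)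
    (h : i + k = l) :
    p ^ i • cocyclicGen hp σ l hl =
      cocyclicGen hp σ k (le_trans (by exact_mod_cast (by omega : k ≤ l)) hl) := by
  subst h
  exact Subtype.ext (by simpa [cocyclicGen] using pow_nsmul_inv_pow hp i k)

theorem isPPrimary_cocyclicGroup (σ : ℕ∞) : IsPPrimary p (cocyclicGroup p σ) := by
  rintro ⟨x, k, hk, hx⟩
  exact ⟨k, Subtype.ext hx⟩

theorem pow_nsmul_cocyclicGroup (j : ℕ) (x : cocyclicGroup p (j : ℕ∞)) : p ^ j • x = 0 := by
  obtain ⟨x, k, hk, hx⟩ := x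
  have hk : k ≤ j := by exact_mod_cast hk
  refine Subtype.ext ?_
  change p ^ j • x = 0
  rw [← Nat.sub_add_cancel hk, pow_add, mul_smul, hx, smul_zero]

theorem isPDivisible_cocyclicGroup_top (hp : p.Prime) :
    IsPDivisible p (cocyclicGroup p (⊤ : ℕ∞)) := by
  intro x
  obtain ⟨k, hk⟩ := isPPrimary_cocyclicGroup _ x
  obtain ⟨n, rfl⟩ := exists_zsmul_cocyclicGen hp le_top x hk
  refine ⟨n • cocyclicGen hp ⊤ (1 + k) le_top, ?_⟩
  rw [smul_comm]
  congr 1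
  simpa using pow_nsmul_cocyclicGen hp (σ := ⊤) (i := 1) (k := k) le_top rfl

theorem finite_socle_cocyclicGroup (hp : p.Prime) (σ : ℕ∞) :
    {x : cocyclicGroup p σ | p • x = 0}.Finite := by
  have h : {x : AddCircle (1 : ℚ) | p • x = 0}.Finite := by
    refine (Set.finite_range (fun i : Fin p =>
      (i : ℤ) • (((p ^ 1 : ℚ)⁻¹ : ℚ) : AddCircle (1 : ℚ)))).subset ?_
    intro x hx
    obtain ⟨n, rfl⟩ := exists_zsmul_inv_pow hp 1 x (by simpa using hx)
    have hpos : (0 : ℤ) < p := by exact_mod_cast hp.pos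
    refine ⟨⟨(n % p).toNat, ?_⟩, ?_⟩
    · have := Int.emod_lt_of_pos n hpos
      have := Int.emod_nonneg n hpos.ne'
      omega
    · change ((n % p).toNat : ℤ) • _ = _
      rw [Int.toNat_of_nonneg (Int.emod_nonneg n hpos.ne'), ← sub_eq_zero, ← sub_smul,
        zsmul_inv_pow_eq_zero_iff hp, pow_one]
      exact Int.emod_emod_of_dvd n dvd_rfl |> Int.ModEq.dvd |> fun h => by
        simpa using (dvd_neg.mpr h)
  refine (h.preimage (Subtype.val_injective.injOn)).subset ?_
  intro x hx
  exact congrArg Subtype.val hx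

end Cocyclic

/-! ### Direct sums of copies of one group. -/

section Finsupp

variable {p : ℕ} {ι : Type*}

theorem linearCombination_single_apply {Z : Type*} [AddCommGroup Z] (g : ι → Z) (c : ι →₀ ℤ)
    (i : ι) :
    Finsupp.linearCombination ℤ (fun j => Finsupp.single j (g j)) c i = c i • g i := by
  classical
  induction c using Finsupp.induction_linear with
  | zero => simp
  | add a b ha hb => simp [ha, hb, add_smul]
  | single j n =>
    rw [Finsupp.linearCombination_single, Finsupp.smul_single, Finsupp.single_apply,
      Finsupp.single_apply]
    split_ifs with h
    · rw [h]
    · simp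

theorem exists_linearCombination_single {Z : Type*} [AddCommGroup Z] (g : ι → Z) (x : ι →₀ Z)
    (h : ∀ i, ∃ n : ℤ, n • g i = x i) :
    ∃ c : ι →₀ ℤ, Finsupp.linearCombination ℤ (fun j => Finsupp.single j (g j)) c = x := by
  classical
  choose n hn using h
  refine ⟨Finsupp.onFinset x.support (fun i => if x i = 0 then 0 else n i) ?_, ?_⟩
  · intro i hi
    rw [Finsupp.mem_support_iff]
    intro h0
    simp [h0] at hi
  · ext i
    rw [linearCombination_single_apply, Finsupp.onFinset_apply]
    split_ifs with h0
    · rw [h0, zero_smul]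
    · exact hn i

theorem IsPPrimary.finsupp {Z : Type*} [AddCommGroup Z] (hZ : IsPPrimary p Z) :
    IsPPrimary p (ι →₀ Z) := by
  intro x
  induction x using Finsupp.induction_linear with
  | zero => exact ⟨0, by simp⟩
  | add a b ha hb =>
    obtain ⟨m, hm⟩ := ha
    obtain ⟨n, hn⟩ := hb
    refine ⟨m + n, ?_⟩
    rw [smul_add, pow_add, mul_smul _ _ b, hn, mul_comm, mul_smul, hm]
    simp
  | single i z =>
    obtain ⟨n, hn⟩ := hZ z
    exact ⟨n, by rw [Finsupp.smul_single, hn, Finsupp.single_zero]⟩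

theorem exists_pow_nsmul_finsupp {Z : Type*} [AddCommGroup Z] {m : ℕ} (x : ι →₀ Z)
    (h : ∀ i, ∃ z : Z, m • z = x i) : ∃ y : ι →₀ Z, m • y = x := by
  classical
  choose n hn using h
  refine ⟨Finsupp.onFinset x.support (fun i => if x i = 0 then 0 else n i) ?_, ?_⟩
  · intro i hi
    rw [Finsupp.mem_support_iff]
    intro h0
    simp [h0] at hi
  · ext i
    rw [Finsupp.smul_apply, Finsupp.onFinset_apply]
    split_ifs with h0
    · rw [h0, smul_zero]
    · exact hn i

theorem IsPDivisible.finsupp {Z : Type*} [AddCommGroup Z] (hZ : IsPDivisible p Z) :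
    IsPDivisible p (ι →₀ Z) := fun x => exists_pow_nsmul_finsupp x fun i => hZ (x i)

end Finsupp

/-! ### Independence and bases in the socle. -/

section Independence

variable {p : ℕ} {ι : Type*} {M : Type*} [AddCommGroup M]

/-- The elements `v i` of order `p` are linearly independent over the field with `p` elements. -/
def IsSocleIndependent (p : ℕ) (v : ι → M) : Prop :=
  (∀ i, p • v i = 0) ∧
    ∀ c : ι →₀ ℤ, Finsupp.linearCombination ℤ v c = 0 → ∀ i, (p : ℤ) ∣ c i

theorem linearCombination_eq_zero_of_dvd {y : ι → M} {n : ι → ℕ} (h : ∀ i, p ^ n i • y i = 0)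
    (c : ι →₀ ℤ) (hc : ∀ i, (p : ℤ) ^ n i ∣ c i) : Finsupp.linearCombination ℤ y c = 0 := by
  rw [Finsupp.linearCombination_apply]
  refine Finset.sum_eq_zero fun i _ => ?_
  obtain ⟨k, hk⟩ := hc i
  dsimp only
  rw [hk, mul_comm, mul_smul]
  have : ((p : ℤ) ^ n i) • y i = 0 := by
    rw [← h i, ← natCast_zsmul]; push_cast; rfl
  rw [this, smul_zero]

/-- The coefficient vector is recorded by `e` in a sum of Prüfer groups, where vanishing means
exactly the claimed divisibility. If `e c` were non-zero, a multiple p^r c would have a non-zero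
image in the socle. Its coefficients are then divisible by p^(n i), and the quotients form a
relation among the v i, hence are divisible by p, a contradiction. -/
theorem IsSocleIndependent.dvd_of_linearCombination_eq_zero (hp : p.Prime) {v y : ι → M}
    (hv : IsSocleIndependent p v) {n : ι → ℕ} (hy : ∀ i, p ^ n i • y i = v i) (c : ι →₀ ℤ)
    (hc : Finsupp.linearCombination ℤ y c = 0) (i : ι) : (p : ℤ) ^ (n i + 1) ∣ c i := by
  set e := Finsupp.linearCombination ℤ (fun j => Finsupp.single j
    (cocyclicGen hp ⊤ (n j + 1) le_top)) with he
  have hei : ∀ c i, e c i = 0 ↔ (p : ℤ) ^ (n i + 1) ∣ c i := by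
    intro c i
    rw [he, linearCombination_single_apply, zsmul_cocyclicGen]
  rw [← hei]
  suffices h : e c = 0 by rw [h, Finsupp.zero_apply]
  by_contra hne
  obtain ⟨r, hr, hr'⟩ := (isPPrimary_cocyclicGroup (p := p) ⊤).finsupp.exists_pow_ne_zero hne
  rw [← map_nsmul] at hr
  rw [← map_nsmul, ← map_nsmul] at hr'
  have hc' : Finsupp.linearCombination ℤ y (p ^ r • c) = 0 := by rw [map_nsmul, hc, smul_zero]
  set b := p ^ r • c with hb
  have hdvd : ∀ i, (p : ℤ) ^ n i ∣ b i := by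
    intro i
    have h1 := (hei (p • b) i).mp (by rw [hr', Finsupp.zero_apply])
    rw [Finsupp.smul_apply, nsmul_eq_mul, pow_succ'] at h1
    exact (mul_dvd_mul_iff_left (by exact_mod_cast hp.ne_zero)).mp h1
  choose d hd using hdvd
  have hd0 : ∀ i, d i ≠ 0 → i ∈ b.support := by
    intro i hi
    rw [Finsupp.mem_support_iff, hd]
    exact mul_ne_zero (pow_ne_zero _ (by exact_mod_cast hp.ne_zero)) hi
  refine hr (Finsupp.ext fun i => ?_)
  rw [Finsupp.zero_apply, hei, hd, pow_succ]
  refine mul_dvd_mul_left _ (hv.2 (Finsupp.onFinset b.support d hd0) ?_ i)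
  rw [← hc', Finsupp.linearCombination_apply, Finsupp.linearCombination_apply,
    Finsupp.onFinset_sum _ (by simp), Finsupp.sum]
  refine Finset.sum_congr rfl fun j _ => ?_
  rw [hd, ← hy j, ← natCast_zsmul, smul_smul]
  push_cast
  rw [mul_comm]

theorem exists_basis_of_zmod_module.{u} [Fact p.Prime] {W : Type u} [AddCommGroup W]
    [Module (ZMod p) W] : ∃ (κ : Type u) (v : κ → W),
      (∀ c : κ →₀ ℤ, Finsupp.linearCombination ℤ v c = 0 → ∀ i, (p : ℤ) ∣ c i) ∧
      ∀ x : W, ∃ c : κ →₀ ℤ, Finsupp.linearCombination ℤ v c = x := by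
  obtain ⟨κ, ⟨b⟩⟩ : ∃ κ : Type u, Nonempty (Module.Basis κ (ZMod p) W) :=
    ⟨_, ⟨Module.Basis.ofVectorSpace (ZMod p) W⟩⟩
  have key : ∀ c : κ →₀ ℤ, Finsupp.linearCombination (ZMod p) b
      (c.mapRange (Int.cast : ℤ → ZMod p) Int.cast_zero) = Finsupp.linearCombination ℤ b c := by
    intro c
    rw [Finsupp.linearCombination_apply, Finsupp.linearCombination_apply,
      Finsupp.sum_mapRange_index (by simp)]
    exact Finset.sum_congr rfl fun i _ => Int.cast_smul_eq_zsmul (ZMod p) (c i) (b i)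
  refine ⟨κ, b, fun c hc i => ?_, fun x => ?_⟩
  · rw [← key] at hc
    have h2 := DFunLike.congr_fun ((linearIndependent_iff.mp b.linearIndependent) _ hc) i
    rw [Finsupp.mapRange_apply, Finsupp.zero_apply] at h2
    exact (ZMod.intCast_zmod_eq_zero_iff_dvd _ _).mp h2
  · refine ⟨(b.repr x).mapRange (fun z : ZMod p => (z.val : ℤ)) (by simp), ?_⟩
    rw [← key]
    have : ((b.repr x).mapRange (fun z : ZMod p => (z.val : ℤ)) (by simp)).mapRange
        (Int.cast : ℤ → ZMod p) Int.cast_zero = b.repr x := by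
      ext i
      simp
    rw [this, b.linearCombination_repr]

/-- A subgroup of the socle has a basis. -/
theorem exists_socle_basis.{u} (hp : p.Prime) {M : Type u} [AddCommGroup M] (W : AddSubgroup M)
    (hW : ∀ x ∈ W, p • x = 0) :
    ∃ (κ : Type u) (v : κ → M), IsSocleIndependent p v ∧ (∀ i, v i ∈ W) ∧
      ∀ x ∈ W, ∃ c : κ →₀ ℤ, Finsupp.linearCombination ℤ v c = x := by
  have := Fact.mk hp
  let _ : Module (ZMod p) W := AddCommGroup.zmodModule (fun x => Subtype.ext (hW x x.2))
  obtain ⟨κ, v, hv, hv'⟩ := exists_basis_of_zmod_module (p := p) (W := W)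
  have key : ∀ c : κ →₀ ℤ, ((Finsupp.linearCombination ℤ v c : W) : M) =
      Finsupp.linearCombination ℤ (fun i => (v i : M)) c := fun c =>
    Finsupp.apply_linearCombination ℤ W.subtype.toIntLinearMap v c
  refine ⟨κ, fun i => v i, ⟨fun i => hW _ (v i).2, fun c hc => hv c (Subtype.ext ?_)⟩,
    fun i => (v i).2, fun x hx => ?_⟩
  · rw [key, hc]; rfl
  · obtain ⟨c, hc⟩ := hv' ⟨x, hx⟩
    exact ⟨c, by rw [← key, hc]⟩

end Independence

/-! ### Embedding sums of cocyclic groups over a prescribed socle. -/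

section Embedding

variable {p : ℕ}

theorem exists_nsmul_cocyclicGroup (hp : p.Prime) {σ : ℕ∞} {m : ℕ} (hσ : ((m + 1 : ℕ) : ℕ∞) ≤ σ)
    (x : cocyclicGroup p σ) (hx : p • x = 0) : ∃ y, p ^ m • y = x := by
  obtain ⟨n, rfl⟩ := exists_zsmul_cocyclicGen hp (σ := σ) (k := 1)
    (le_trans (by exact_mod_cast (by omega : 1 ≤ m + 1)) hσ) x (by simpa using hx)
  refine ⟨n • cocyclicGen hp σ (m + 1) hσ, ?_⟩
  rw [smul_comm, pow_nsmul_cocyclicGen hp hσ rfl]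

theorem exists_nsmul_finsupp_cocyclicGroup (hp : p.Prime) {ι : Type*} {σ : ℕ∞} {m : ℕ}
    (hσ : ((m + 1 : ℕ) : ℕ∞) ≤ σ) (x : ι →₀ cocyclicGroup p σ) (hx : p • x = 0) :
    ∃ y, p ^ m • y = x :=
  exists_pow_nsmul_finsupp x fun i => exists_nsmul_cocyclicGroup hp hσ (x i) (by
    rw [← Finsupp.smul_apply, hx, Finsupp.zero_apply])

theorem pow_nsmul_finsupp_cocyclicGroup {ι : Type*} (j : ℕ)
    (x : ι →₀ cocyclicGroup p (j : ℕ∞)) : p ^ j • x = 0 := by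
  ext i
  rw [Finsupp.smul_apply, pow_nsmul_cocyclicGroup, Finsupp.zero_apply]

theorem finite_socle_finsupp_cocyclicGroup (hp : p.Prime) {ι : Type*} [Finite ι] (σ : ℕ∞) :
    {x : ι →₀ cocyclicGroup p σ | p • x = 0}.Finite := by
  refine ((Set.Finite.pi' (fun _ : ι => finite_socle_cocyclicGroup hp σ)).preimage
    (f := fun x : ι →₀ cocyclicGroup p σ => (x : ι → _))
    (DFunLike.coe_injective.injOn)).subset ?_
  intro x hx i
  exact (Finsupp.smul_apply p x i).symm.trans (by rw [show p • x = 0 from hx]; rfl)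

variable {M : Type*} [AddCommGroup M] {ι : Type*}

theorem mem_range_linearCombination (hp : p.Prime) {σ : ℕ∞} (hσ : ((1 : ℕ) : ℕ∞) ≤ σ)
    {v : ι → M} (θ : (ι →₀ cocyclicGroup p σ) →+ M)
    (hθ : ∀ i, θ (Finsupp.single i (cocyclicGen hp σ 1 hσ)) = v i)
    (x : ι →₀ cocyclicGroup p σ) (hx : p • x = 0) :
    ∃ c : ι →₀ ℤ, Finsupp.linearCombination ℤ v c = θ x := by
  obtain ⟨c, rfl⟩ := exists_linearCombination_single (fun _ => cocyclicGen hp σ 1 hσ) x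
    (fun i => exists_zsmul_cocyclicGen hp hσ (x i) (by
      rw [pow_one, ← Finsupp.smul_apply, hx, Finsupp.zero_apply]))
  refine ⟨c, ?_⟩
  rw [← funext hθ]
  exact (Finsupp.apply_linearCombination ℤ θ.toIntLinearMap _ c).symm

/-- Both groups are images of the free group on ι. Independence of the v i says that the two kernels
coincide, so generator i can be sent to y i injectively. -/
theorem exists_homocyclic_embedding (hp : p.Prime) {j : ℕ} {v y : ι → M}
    (hv : IsSocleIndependent p v) (hy : ∀ i, p ^ j • y i = v i) :
    ∃ θ : (ι →₀ cocyclicGroup p ((j + 1 : ℕ) : ℕ∞)) →+ M, Function.Injective θ ∧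
      ∀ i, θ (Finsupp.single i (cocyclicGen hp _ 1 (by exact_mod_cast Nat.le_add_left 1 j))) =
        v i := by
  set e := (Finsupp.linearCombination ℤ (fun i : ι => Finsupp.single i
    (cocyclicGen hp ((j + 1 : ℕ) : ℕ∞) (j + 1) le_rfl))).toAddMonoidHom with he
  have hec : ∀ c, e c = 0 ↔ ∀ i, (p : ℤ) ^ (j + 1) ∣ c i := by
    intro c
    rw [DFunLike.ext_iff]
    refine forall_congr' fun i => ?_
    rw [← zsmul_cocyclicGen hp (σ := ((j + 1 : ℕ) : ℕ∞)) le_rfl,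
      ← linearCombination_single_apply (fun _ => cocyclicGen hp ((j + 1 : ℕ) : ℕ∞) (j + 1) le_rfl)]
    rfl
  have hsurj : Function.Surjective e := fun x =>
    exists_linearCombination_single _ x fun i =>
      exists_zsmul_cocyclicGen hp le_rfl (x i) (pow_nsmul_cocyclicGroup (j + 1) (x i))
  obtain ⟨θ, hθ⟩ := exists_comp_eq_of_surjective e hsurj
    (Finsupp.linearCombination ℤ y).toAddMonoidHom (fun c hc =>
      linearCombination_eq_zero_of_dvd (n := fun _ => j + 1)
        (fun i => by rw [pow_succ', mul_smul, hy, hv.1]) c ((hec c).mp hc))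
  refine ⟨θ, ?_, fun i => ?_⟩
  · rw [injective_iff_map_eq_zero]
    intro x hx
    obtain ⟨c, rfl⟩ := hsurj x
    rw [hθ] at hx
    exact (hec c).mpr (hv.dvd_of_linearCombination_eq_zero hp hy c hx)
  · have h1 := hθ (Finsupp.single i ((p : ℤ) ^ j))
    have h2 : e (Finsupp.single i ((p : ℤ) ^ j)) = Finsupp.single i
        (cocyclicGen hp _ 1 (by exact_mod_cast Nat.le_add_left 1 j)) := by
      change Finsupp.linearCombination ℤ _ _ = _
      rw [Finsupp.linearCombination_single, Finsupp.smul_single,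
        ← pow_nsmul_cocyclicGen hp (i := j) (k := 1) le_rfl rfl, ← natCast_zsmul]
      push_cast
      rfl
    rw [h2] at h1
    rw [h1]
    change Finsupp.linearCombination ℤ _ _ = _
    rw [Finsupp.linearCombination_single, ← hy, ← natCast_zsmul]
    push_cast
    rfl

/-- The map is prescribed on the socle and extended by injectivity of M. It is injective because it
is so on the socle. -/
theorem exists_divisible_embedding (hp : p.Prime) (hM : IsPPrimary p M) (hd : IsPDivisible p M)
    {v : ι → M} (hv : IsSocleIndependent p v) :
    ∃ θ : (ι →₀ cocyclicGroup p (⊤ : ℕ∞)) →+ M, Function.Injective θ ∧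
      ∀ i, θ (Finsupp.single i (cocyclicGen hp ⊤ 1 le_top)) = v i := by
  have hec : ∀ (c : ι →₀ ℤ), Finsupp.linearCombination ℤ (fun i : ι => Finsupp.single i
      (cocyclicGen hp (⊤ : ℕ∞) 1 le_top)) c = 0 ↔ ∀ i, (p : ℤ) ∣ c i := by
    intro c
    rw [DFunLike.ext_iff]
    refine forall_congr' fun i => ?_
    rw [linearCombination_single_apply, Finsupp.zero_apply, zsmul_cocyclicGen, pow_one]
  obtain ⟨θ, hθ⟩ := hd.exists_comp_eq hp hM (Finsupp.linearCombination ℤ (fun i : ι =>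
      Finsupp.single i (cocyclicGen hp (⊤ : ℕ∞) 1 le_top))).toAddMonoidHom
    (Finsupp.linearCombination ℤ v).toAddMonoidHom (fun c hc =>
      linearCombination_eq_zero_of_dvd (p := p) (n := fun _ => 1)
        (fun i => by rw [pow_one, hv.1]) c (by simpa using (hec c).mp hc))
  have hθi : ∀ i, θ (Finsupp.single i (cocyclicGen hp ⊤ 1 le_top)) = v i := by
    intro i
    simpa using hθ (Finsupp.single i 1)
  refine ⟨θ, (isPPrimary_cocyclicGroup ⊤).finsupp.injective_of_socle _ ?_, hθi⟩
  intro x hpx hx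
  obtain ⟨c, rfl⟩ := exists_linearCombination_single (fun _ => cocyclicGen hp ⊤ 1 le_top) x
    (fun i => exists_zsmul_cocyclicGen hp le_top (x i) (by
      rw [pow_one, ← Finsupp.smul_apply, hpx, Finsupp.zero_apply]))
  exact (hec c).mpr (hv.2 c ((hθ c).symm.trans hx))

end Embedding

/-! ### Splitting off homocyclic and divisible summands. -/

section Structure

universe u

variable {p : ℕ} {A : Type u} [AddCommGroup A]

theorem mem_iff_of_socle_basis (hp : p.Prime) {W : AddSubgroup A} {κ : Type*} {v : κ → A}
    (hW : ∀ x ∈ W, p • x = 0) (hv : ∀ i, v i ∈ W)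
    (hs : ∀ x ∈ W, ∃ c : κ →₀ ℤ, Finsupp.linearCombination ℤ v c = x) {σ : ℕ∞}
    (hσ : ((1 : ℕ) : ℕ∞) ≤ σ) (θ : (κ →₀ cocyclicGroup p σ) →+ A) (hinj : Function.Injective θ)
    (hθ : ∀ i, θ (Finsupp.single i (cocyclicGen hp σ 1 hσ)) = v i) (x : A) :
    x ∈ W ↔ p • x = 0 ∧ x ∈ θ.range := by
  constructor
  · intro hx
    refine ⟨hW x hx, ?_⟩
    obtain ⟨c, rfl⟩ := hs x hx
    refine ⟨Finsupp.linearCombination ℤ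
      (fun i => Finsupp.single i (cocyclicGen hp σ 1 hσ)) c, ?_⟩
    rw [← funext hθ]
    exact Finsupp.apply_linearCombination ℤ θ.toIntLinearMap _ c
  · rintro ⟨hpx, z, rfl⟩
    obtain ⟨c, hc⟩ := mem_range_linearCombination hp hσ θ hθ z
      (hinj (by rw [map_nsmul, hpx, map_zero]))
    rw [← hc, Finsupp.linearCombination_apply]
    exact sum_mem fun i _ => W.zsmul_mem (hv i) _

/-- A subgroup of the socle consisting of elements of height at least `j` is the socle of a
homocyclic subgroup of exponent `p ^ (j + 1)`. -/
theorem exists_homocyclic_of_le_heightSocle (hp : p.Prime) {j : ℕ} {W : AddSubgroup A}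
    (hW : W ≤ heightSocle p j A) :
    ∃ (κ : Type u) (θ : (κ →₀ cocyclicGroup p ((j + 1 : ℕ) : ℕ∞)) →+ A), Function.Injective θ ∧
      ∀ x, x ∈ W ↔ p • x = 0 ∧ x ∈ θ.range := by
  have hW0 : ∀ x ∈ W, p • x = 0 := fun x hx => (mem_heightSocle.mp (hW hx)).1
  obtain ⟨κ, v, hv, hvW, hs⟩ := exists_socle_basis hp W hW0
  choose y hy using fun i => (mem_heightSocle.mp (hW (hvW i))).2
  obtain ⟨θ, hinj, hθ⟩ := exists_homocyclic_embedding hp hv hy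
  exact ⟨κ, θ, hinj, mem_iff_of_socle_basis hp hW0 hvW hs _ θ hinj hθ⟩

/-- A subgroup of the socle of a divisible group is the socle of a divisible subgroup. -/
theorem exists_divisible_of_le_socle (hp : p.Prime) (hA : IsPPrimary p A)
    (hd : IsPDivisible p A) {W : AddSubgroup A} (hW : ∀ x ∈ W, p • x = 0) :
    ∃ (κ : Type u) (θ : (κ →₀ cocyclicGroup p (⊤ : ℕ∞)) →+ A), Function.Injective θ ∧
      ∀ x, x ∈ W ↔ p • x = 0 ∧ x ∈ θ.range := by
  obtain ⟨κ, v, hv, hvW, hs⟩ := exists_socle_basis hp W hW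
  obtain ⟨θ, hinj, hθ⟩ := exists_divisible_embedding hp hA hd hv
  exact ⟨κ, θ, hinj, mem_iff_of_socle_basis hp hW hvW hs _ θ hinj hθ⟩

/-- W is a vector space over the field with p elements; its splitting is the complement theorem with
m = 0, applied inside W. -/
theorem exists_socle_complement (hp : p.Prime) {W : AddSubgroup A} (H : AddSubgroup A)
    (hW : ∀ x ∈ W, p • x = 0) : ∃ V ≤ W, Disjoint V H ∧ W ≤ V ⊔ H := by
  have hWp : IsPPrimary p W := fun x => ⟨1, Subtype.ext (by simpa using hW x x.2)⟩
  obtain ⟨C, -, hC⟩ := exists_isCompl_of_disjoint_pMultiples hp hWp (m := 0)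
    (Y := H.addSubgroupOf W) (fun x _ => ⟨x, by simp⟩) (by
      rw [AddSubgroup.disjoint_def]
      intro x _ hx
      obtain ⟨y, rfl⟩ := mem_pMultiples.mp hx
      exact Subtype.ext (by simpa using hW y y.2))
  refine ⟨C.map W.subtype, AddSubgroup.map_subtype_le C, ?_, ?_⟩
  · rw [AddSubgroup.disjoint_def]
    rintro _ ⟨x, hx, rfl⟩ hxH
    exact congrArg Subtype.val (AddSubgroup.disjoint_def.mp hC.disjoint
      (AddSubgroup.mem_addSubgroupOf.mpr hxH) hx)
  · intro x hx
    obtain ⟨a, ha, c, hc, hac⟩ := AddSubgroup.mem_sup.mp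
      (hC.codisjoint.eq_top ▸ AddSubgroup.mem_top (⟨x, hx⟩ : W))
    rw [show x = (c : A) + a by rw [add_comm]; exact (congrArg Subtype.val hac).symm]
    exact AddSubgroup.add_mem_sup ⟨c, hc, rfl⟩ (AddSubgroup.mem_addSubgroupOf.mp ha)

theorem exists_socle_range {B : Type*} [AddCommGroup B] {m : ℕ} (f : B →+ A)
    (hf : Function.Injective f) (h : ∀ x : B, p • x = 0 → ∃ y, p ^ m • y = x) (x : f.range)
    (hx : p • x = 0) : ∃ y : f.range, p ^ m • y = x := by
  obtain ⟨_, b, rfl⟩ := x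
  obtain ⟨y, rfl⟩ := h b (hf (by simpa using congrArg Subtype.val hx))
  exact ⟨⟨f y, y, rfl⟩, Subtype.ext (map_nsmul f _ _).symm⟩

theorem disjoint_of_socle (hA : IsPPrimary p A) {Y C : AddSubgroup A}
    (h : ∀ x ∈ Y, x ∈ C → p • x = 0 → x = 0) : Disjoint Y C := by
  rw [AddSubgroup.disjoint_def]
  intro x hY hC
  by_contra hne
  obtain ⟨r, hr, hr'⟩ := hA.exists_pow_ne_zero hne
  exact hr (h _ (Y.nsmul_mem hY _) (C.nsmul_mem hC _) hr')

/-- If the socle consists of elements of height at least `j`, a maximal homocyclic subgroup of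
exponent `p ^ (j + 1)` splits off and leaves a socle of height at least `j + 1`. -/
theorem exists_isCompl_homocyclic (hp : p.Prime) (hA : IsPPrimary p A) {j : ℕ}
    (h : ∀ x : A, p • x = 0 → ∃ y, p ^ j • y = x) :
    ∃ (κ : Type u) (θ : (κ →₀ cocyclicGroup p ((j + 1 : ℕ) : ℕ∞)) →+ A) (C : AddSubgroup A),
      Function.Injective θ ∧ IsCompl θ.range C ∧
        ∀ x : C, p • x = 0 → ∃ y : C, p ^ (j + 1) • y = x := by
  obtain ⟨V, hVW, hVH, hsup⟩ := exists_socle_complement hp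
    (W := heightSocle p j A) (heightSocle p (j + 1) A) (fun x hx => (mem_heightSocle.mp hx).1)
  obtain ⟨κ, θ, hinj, hθ⟩ := exists_homocyclic_of_le_heightSocle hp hVW
  obtain ⟨C, hC, hcompl⟩ := exists_isCompl_of_disjoint_pMultiples hp hA (m := j) (Y := θ.range)
    (exists_socle_range θ hinj (exists_nsmul_finsupp_cocyclicGroup hp le_rfl))
    (disjoint_of_socle hA fun x hx hx' hpx => AddSubgroup.disjoint_def.mp hVH
      ((hθ x).mpr ⟨hpx, hx⟩) (mem_heightSocle.mpr ⟨hpx, mem_pMultiples.mp hx'⟩))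
  refine ⟨κ, θ, C, hinj, hcompl, ?_⟩
  rintro ⟨x, hxC⟩ hx
  have hx : p • x = 0 := congrArg Subtype.val hx
  obtain ⟨w, hw, y, hy, rfl⟩ := AddSubgroup.mem_sup.mp (hsup (mem_heightSocle.mpr ⟨hx, h x hx⟩))
  obtain ⟨a, ha⟩ := (mem_heightSocle.mp hy).2
  have hyC : y ∈ C := hC (mem_pMultiples.mpr ⟨a, ha⟩)
  have hw0 : w = 0 := AddSubgroup.disjoint_def.mp hcompl.disjoint ((hθ w).mp hw).2 (by
    simpa using sub_mem hxC hyC)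
  obtain ⟨_, ⟨z, rfl⟩, c, hc, rfl⟩ := AddSubgroup.mem_sup.mp
    (hcompl.codisjoint.eq_top ▸ AddSubgroup.mem_top a)
  refine ⟨⟨c, hc⟩, Subtype.ext ?_⟩
  change p ^ (j + 1) • c = w + y
  rw [hw0, zero_add, ← ha, smul_add, ← map_nsmul, pow_nsmul_finsupp_cocyclicGroup, map_zero,
    zero_add]

/-- The decomposition of a group given by an embedding and a complement of its range. -/
theorem nonempty_prod_addEquiv {B : Type*} [AddCommGroup B] (θ : B →+ A)
    (hθ : Function.Injective θ) {C : AddSubgroup A} (hC : IsCompl θ.range C) :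
    ∃ e : (B × C) ≃+ A, ∀ b c, e (b, c) = θ b + c := by
  refine ⟨AddEquiv.ofBijective (θ.coprod C.subtype) ⟨?_, ?_⟩, fun b c => rfl⟩
  · rw [injective_iff_map_eq_zero]
    rintro ⟨b, c⟩ hbc
    have hbc : θ b + c = 0 := hbc
    have hb : θ b = 0 := AddSubgroup.disjoint_def.mp hC.disjoint ⟨b, rfl⟩ (by
      rw [eq_neg_of_add_eq_zero_left hbc]
      exact neg_mem c.2)
    rw [hb, zero_add] at hbc
    exact Prod.ext ((injective_iff_map_eq_zero θ).mp hθ b hb) (Subtype.ext hbc)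
  · intro a
    obtain ⟨_, ⟨b, rfl⟩, c, hc, rfl⟩ := AddSubgroup.mem_sup.mp
      (hC.codisjoint.eq_top ▸ AddSubgroup.mem_top a)
    exact ⟨(b, ⟨c, hc⟩), rfl⟩

/-- Splitting off the first factor of a product indexed by `Fin (n + 1)`. -/
def finSuccPiAddEquiv {n : ℕ} (P : Fin (n + 1) → Type*) [∀ i, AddCommGroup (P i)] :
    ((i : Fin (n + 1)) → P i) ≃+ P 0 × ((i : Fin n) → P i.succ) where
  toFun f := (f 0, fun i => f i.succ)
  invFun f := Fin.cons f.1 f.2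
  left_inv f := Fin.cons_self_tail f
  right_inv _ := rfl
  map_add' _ _ := rfl

/-- A `p`-divisible `p`-primary group is a direct sum of Prüfer groups. -/
theorem IsPDivisible.exists_addEquiv (hp : p.Prime) (hA : IsPPrimary p A)
    (hdiv : IsPDivisible p A) :
    ∃ κ : Type u, Nonempty (A ≃+ (κ →₀ cocyclicGroup p (⊤ : ℕ∞))) := by
  obtain ⟨κ, θ, hinj, hθ⟩ := exists_divisible_of_le_socle hp hA hdiv
    (W := (nsmulAddMonoidHom p : A →+ A).ker) (fun x hx => hx)
  have hrange : IsPDivisible p θ.range :=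
    ((isPDivisible_cocyclicGroup_top hp).finsupp).of_surjective _ θ.rangeRestrict_surjective
  obtain ⟨C, hC⟩ := hrange.exists_isCompl hp hA
  have hC0 : C = ⊥ := by
    have : Disjoint C C := disjoint_of_socle hA fun x hx _ hpx =>
      AddSubgroup.disjoint_def.mp hC.disjoint ((hθ x).mp hpx).2 hx
    exact disjoint_self.mp this
  have hsurj : Function.Surjective θ := by
    rw [← AddMonoidHom.range_eq_top]
    simpa [hC0] using hC.codisjoint.eq_top
  exact ⟨κ, ⟨(AddEquiv.ofBijective θ ⟨hinj, hsurj⟩).symm⟩⟩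

/-- Here d counts the heights that remain before every socle element has infinite height. Each step
removes a homocyclic summand of exponent p^(j+1); at d = 0 the group is divisible. -/
theorem exists_cocyclic_decomposition (hp : p.Prime) (d : ℕ) :
    ∀ (A : Type u) [AddCommGroup A] (j : ℕ), IsPPrimary p A →
      (∀ x : A, p • x = 0 → ∃ y, p ^ j • y = x) →
      (∀ x : A, p • x = 0 → (∃ y, p ^ (j + d) • y = x) → ∀ i, ∃ y, p ^ i • y = x) →
      ∃ (n : ℕ) (σ : Fin n → ℕ∞) (ι : Fin n → Type u), StrictMono σ ∧
        (∀ k, ((j + 1 : ℕ) : ℕ∞) ≤ σ k) ∧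
          Nonempty (A ≃+ ((k : Fin n) → (ι k →₀ cocyclicGroup p (σ k)))) := by
  induction d with
  | zero =>
    intro A _ j hA hj hd
    have hdiv : IsPDivisible p A :=
      hA.isPDivisible_of_socle fun x hx => hd x hx (hj x hx)
    obtain ⟨κ, ⟨e⟩⟩ := hdiv.exists_addEquiv hp hA
    exact ⟨1, fun _ => ⊤, fun _ => κ, Subsingleton.strictMono _, fun _ => le_top,
      ⟨e.trans (AddEquiv.funUnique (Fin 1) _).symm⟩⟩
  | succ d ih =>
    intro A _ j hA hj hd
    obtain ⟨κ, θ, C, hinj, hC, hsoc⟩ := exists_isCompl_homocyclic hp hA hj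
    obtain ⟨e, he⟩ := nonempty_prod_addEquiv θ hinj hC
    obtain ⟨n, σ, ι, hσ, hσj, ⟨f⟩⟩ := ih C (j + 1) (hA.addSubgroup C) hsoc (by
      rintro x hx ⟨y, hy⟩ i
      obtain ⟨a, ha⟩ := hd x (congrArg Subtype.val hx)
        ⟨y, by rw [show j + (d + 1) = j + 1 + d by omega]; exact congrArg Subtype.val hy⟩ i
      obtain ⟨⟨b, c⟩, rfl⟩ := e.surjective a
      refine ⟨c, ?_⟩
      have h1 : e (p ^ i • (b, c)) = e (0, x) := by
        rw [map_nsmul, ha, he, map_zero, zero_add]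
      exact congrArg Prod.snd (e.injective h1))
    refine ⟨n + 1, Fin.cons ((j + 1 : ℕ) : ℕ∞) σ, Fin.cons κ ι, ?_, ?_, ?_⟩
    · refine Fin.strictMono_cons.mpr ⟨fun k => lt_of_lt_of_le ?_ (hσj k), hσ⟩
      exact_mod_cast Nat.lt_succ_self (j + 1)
    · intro k
      refine Fin.cases le_rfl (fun k => ?_) k
      exact le_trans (by exact_mod_cast Nat.le_succ _) (hσj k)
    · exact ⟨e.symm.trans (((AddEquiv.refl _).prodCongr f).trans
        (finSuccPiAddEquiv (fun k : Fin (n + 1) => ((Fin.cons κ ι : Fin (n + 1) → Type u) k →₀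
          cocyclicGroup p ((Fin.cons ((j + 1 : ℕ) : ℕ∞) σ : Fin (n + 1) → ℕ∞) k)))).symm)⟩

end Structure

/-! ### Counting torsion in groups with finite socle. -/

section Cardinality

variable {p : ℕ}

theorem card_ker_mul_card_range {P Q : Type*} [AddCommGroup P] [AddCommGroup Q] (f : P →+ Q) :
    Nat.card f.ker * Nat.card f.range = Nat.card P := by
  rw [← AddSubgroup.index_ker, AddSubgroup.card_mul_index]

/-- In a finite group the n-torsion has the same order as the quotient by multiples of n, and L/nL
is a quotient of E/nE. -/
theorem card_ker_nsmul_le_of_surjective {E L : Type*} [AddCommGroup E] [AddCommGroup L] [Finite E]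
    (q : E →+ L) (hq : Function.Surjective q) (n : ℕ) :
    Nat.card (nsmulAddMonoidHom n : L →+ L).ker ≤ Nat.card (nsmulAddMonoidHom n : E →+ E).ker := by
  have : Finite L := Finite.of_surjective q hq
  have h1 := card_ker_mul_card_range (nsmulAddMonoidHom n : E →+ E)
  have h2 := card_ker_mul_card_range (nsmulAddMonoidHom n : L →+ L)
  have h3 : Nat.card q.ker * Nat.card L = Nat.card E := by
    rw [← AddSubgroup.card_mul_index q.ker, AddSubgroup.index_ker,
      AddMonoidHom.range_eq_top.mpr hq, AddSubgroup.card_top]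
  let g := q.comp (nsmulAddMonoidHom n : E →+ E).range.subtype
  have h4 : Nat.card g.ker * Nat.card g.range =
      Nat.card (nsmulAddMonoidHom n : E →+ E).range := card_ker_mul_card_range g
  have h5 : Nat.card g.ker ≤ Nat.card q.ker :=
    Nat.card_le_card_of_injective (fun x : g.ker => (⟨x.1.1, x.2⟩ : q.ker)) (by
      intro x y hxy
      have h := Subtype.ext_iff.mp hxy
      exact Subtype.ext (Subtype.ext h))
  have h6 : Nat.card g.range ≤ Nat.card (nsmulAddMonoidHom n : L →+ L).range := by
    refine Nat.card_mono (Set.toFinite _) ?_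
    rintro _ ⟨⟨_, y, rfl⟩, rfl⟩
    exact ⟨q y, (map_nsmul q n y).symm⟩
  have h7 := Nat.mul_le_mul h5 h6
  have h8 : 0 < Nat.card q.ker * Nat.card (nsmulAddMonoidHom n : L →+ L).range :=
    Nat.mul_pos Nat.card_pos Nat.card_pos
  refine Nat.le_of_mul_le_mul_right ?_ h8
  calc _ = Nat.card q.ker * (Nat.card (nsmulAddMonoidHom n : L →+ L).ker *
        Nat.card (nsmulAddMonoidHom n : L →+ L).range) := by ring
    _ = Nat.card (nsmulAddMonoidHom n : E →+ E).ker *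
        Nat.card (nsmulAddMonoidHom n : E →+ E).range := by rw [h2, h3, h1]
    _ ≤ _ := Nat.mul_le_mul_left _ (h4 ▸ h7)

theorem finite_ker_pow_nsmul {M : Type*} [AddCommGroup M] (h : {x : M | p • x = 0}.Finite)
    (n : ℕ) : {x : M | p ^ n • x = 0}.Finite := by
  induction n with
  | zero => exact (Set.finite_singleton 0).subset fun x hx => by simpa using hx
  | succ n ih =>
    have : {x : M | p ^ (n + 1) • x = 0} = (fun x : M => p • x) ⁻¹' {x | p ^ n • x = 0} := by
      ext x
      simp [pow_succ, mul_smul]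
    rw [this]
    refine ih.preimage' fun b _ => ?_
    by_cases hb : ∃ a, p • a = b
    · obtain ⟨a, rfl⟩ := hb
      refine (h.image (fun x => a + x)).subset fun x hx => ⟨x - a, ?_, by simp⟩
      have hx : p • x = p • a := hx
      simp [smul_sub, hx]
    · exact Set.finite_empty.subset fun x hx => hb ⟨x, hx⟩

/-- An injective homomorphism from a `p`-primary group with finite socle to one of its quotients
is surjective. -/
theorem surjective_of_finite_socle {M X : Type*} [AddCommGroup M] [AddCommGroup X]
    (hM : IsPPrimary p M) (h : {x : M | p • x = 0}.Finite) (q φ : M →+ X)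
    (hq : Function.Surjective q) (hφ : Function.Injective φ) : Function.Surjective φ := by
  classical
  intro x
  by_contra hx
  obtain ⟨n, hn⟩ := hM.of_surjective q hq x
  have hfin := finite_ker_pow_nsmul h n
  -- If x is missed, then x and φ(M[p^n]) give one more element of X[p^n] than M[p^n] has. They all
  -- lift to the finite group E = M[p^N], so q(E) would have more p^n-torsion than E, against the
  -- preceding bound.
  set F : Finset X := insert x (hfin.toFinset.image φ) with hF
  have hFn : ∀ f ∈ F, p ^ n • f = 0 := by
    intro f hf
    rcases Finset.mem_insert.mp hf with rfl | hf
    · exact hn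
    · obtain ⟨a, ha, rfl⟩ := Finset.mem_image.mp hf
      rw [← map_nsmul, (Set.Finite.mem_toFinset hfin).mp ha, map_zero]
  have hcard : F.card = Nat.card (nsmulAddMonoidHom (p ^ n) : M →+ M).ker + 1 := by
    rw [hF, Finset.card_insert_of_notMem, Finset.card_image_of_injective _ hφ,
      ← Set.ncard_eq_toFinset_card _ hfin]
    · rfl
    · intro hmem
      obtain ⟨a, -, ha⟩ := Finset.mem_image.mp hmem
      exact hx ⟨a, ha⟩
  choose m hm using hq
  choose k hk using hM
  set N := F.sup (fun f => k (m f)) with hN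
  have hmN : ∀ f ∈ F, p ^ N • m f = 0 := by
    intro f hf
    rw [hN, ← Nat.sub_add_cancel (Finset.le_sup (f := fun f => k (m f)) hf), pow_add, mul_smul, hk,
      smul_zero]
  let E := (nsmulAddMonoidHom (p ^ N) : M →+ M).ker
  have : Finite E := (finite_ker_pow_nsmul h N).to_subtype
  have : Finite (nsmulAddMonoidHom (p ^ n) : M →+ M).ker := hfin.to_subtype
  let r := (q.comp E.subtype).rangeRestrict
  have : Finite (q.comp E.subtype).range := Finite.of_surjective r
    (q.comp E.subtype).rangeRestrict_surjective
  have h1 := card_ker_nsmul_le_of_surjective r (q.comp E.subtype).rangeRestrict_surjective (p ^ n)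
  have h2 : Nat.card (nsmulAddMonoidHom (p ^ n) : E →+ E).ker ≤
      Nat.card (nsmulAddMonoidHom (p ^ n) : M →+ M).ker :=
    Nat.card_le_card_of_injective
      (fun x => (⟨x.1.1, congrArg Subtype.val x.2⟩ : (nsmulAddMonoidHom (p ^ n) : M →+ M).ker))
      (fun x y hxy => by
        have h := Subtype.ext_iff.mp hxy
        exact Subtype.ext (Subtype.ext h))
  have h3 : Nat.card F ≤ Nat.card (nsmulAddMonoidHom (p ^ n) :
      (q.comp E.subtype).range →+ (q.comp E.subtype).range).ker :=
    Nat.card_le_card_of_injective (fun f : F =>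
      (⟨⟨f.1, ⟨m f.1, hmN f.1 f.2⟩, hm f.1⟩, Subtype.ext (hFn f.1 f.2)⟩ :
        (nsmulAddMonoidHom (p ^ n) :
          (q.comp E.subtype).range →+ (q.comp E.subtype).range).ker))
      (fun x y hxy => Subtype.ext (congrArg (fun z => z.1.1) hxy))
  rw [Nat.card_eq_finsetCard, hcard] at h3
  omega

end Cardinality

/-- `A` is `p`-divisible, or for some `m` its socle has height at least `m` and the elements of
height greater than `m` in the socle are finitely many. -/
def IsNearlyHomogeneous (p : ℕ) (A : Type*) [AddCommGroup A] : Prop :=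
  IsPDivisible p A ∨ ∃ m : ℕ, (∀ x : A, p • x = 0 → ∃ y, p ^ m • y = x) ∧
    Finite (heightSocle p (m + 1) A)

/-! ### Nearly homogeneous means generalized finite p-rank. -/

section Classification

universe u

variable {p : ℕ} {A : Type u} [AddCommGroup A]

theorem IsNearlyHomogeneous.of_addEquiv {B : Type*} [AddCommGroup B] (e : A ≃+ B)
    (hB : IsNearlyHomogeneous p B) : IsNearlyHomogeneous p A := by
  rcases hB with hB | ⟨m, hm, hfin⟩
  · exact Or.inl (hB.of_surjective e.symm.toAddMonoidHom e.symm.surjective)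
  · refine Or.inr ⟨m, fun x hx => ?_, ?_⟩
    · obtain ⟨y, hy⟩ := hm (e x) (by rw [← map_nsmul, hx, map_zero])
      exact ⟨e.symm y, by rw [← map_nsmul, hy, e.symm_apply_apply]⟩
    · refine Finite.of_injective (β := heightSocle p (m + 1) B) (fun x => ⟨e x, ?_⟩) ?_
      · obtain ⟨x, hx⟩ := x
        obtain ⟨h1, y, rfl⟩ := mem_heightSocle.mp hx
        exact mem_heightSocle.mpr ⟨by rw [← map_nsmul, h1, map_zero], e y, (map_nsmul e _ _).symm⟩
      · intro x y hxy
        exact Subtype.ext (e.injective (congrArg Subtype.val hxy))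

/-- Each copy of a cocyclic group of exponent at least m + 1 contributes its own socle element of
height at least m. -/
theorem finite_index_of_finite_heightSocle (hp : p.Prime) {n m : ℕ} {σ : Fin n → ℕ∞}
    {ι : Fin n → Type u} (e : A ≃+ ((k : Fin n) → (ι k →₀ cocyclicGroup p (σ k))))
    (hfin : Finite (heightSocle p m A)) (k : Fin n) (hk : ((m + 1 : ℕ) : ℕ∞) ≤ σ k) :
    Finite (ι k) := by
  classical
  have h1 : ((1 : ℕ) : ℕ∞) ≤ σ k := le_trans (by exact_mod_cast Nat.le_add_left 1 m) hk
  refine Finite.of_injective (β := heightSocle p m A) (fun i => ⟨e.symm (Pi.single k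
    (Finsupp.single i (cocyclicGen hp (σ k) 1 h1))), mem_heightSocle.mpr ⟨?_, e.symm (Pi.single k
    (Finsupp.single i (cocyclicGen hp (σ k) (m + 1) hk))), ?_⟩⟩) ?_
  · have : p • cocyclicGen hp (σ k) 1 h1 = 0 := by
      rw [← natCast_zsmul, zsmul_cocyclicGen, pow_one]
    rw [← map_nsmul, ← Pi.single_smul, Finsupp.smul_single, this, Finsupp.single_zero,
      Pi.single_zero, map_zero]
  · rw [← map_nsmul, ← Pi.single_smul, Finsupp.smul_single,
      pow_nsmul_cocyclicGen hp hk rfl]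
  · intro i j hij
    have h2 := Pi.single_injective k (e.symm.injective (congrArg Subtype.val hij))
    refine Finsupp.single_left_injective ?_ h2
    intro h0
    rw [← one_zsmul (cocyclicGen hp (σ k) 1 h1), zsmul_cocyclicGen, pow_one] at h0
    have := Int.eq_one_of_dvd_one (by positivity) h0
    exact hp.ne_one (by exact_mod_cast this)

theorem exists_stable_heightSocle {m : ℕ} (hfin : Finite (heightSocle p m A)) :
    ∃ d, ∀ i, heightSocle p (m + d) A ≤ heightSocle p i A := by
  have hfin' : ∀ d, Finite (heightSocle p (m + d) A) := fun d =>
    Finite.Set.subset (heightSocle p m A : Set A) (heightSocle_anti (Nat.le_add_right m d))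
  obtain ⟨d, hd⟩ : ∃ d, ∀ d', Nat.card (heightSocle p (m + d) A) ≤
      Nat.card (heightSocle p (m + d') A) := by
    obtain ⟨d, -, hd⟩ := WellFounded.has_min (measure fun d =>
      Nat.card (heightSocle p (m + d) A)).wf Set.univ ⟨0, trivial⟩
    exact ⟨d, fun d' => not_lt.mp (hd d' trivial)⟩
  refine ⟨d, fun i => ?_⟩
  rcases le_total i (m + d) with h | h
  · exact heightSocle_anti h
  · obtain ⟨d', rfl⟩ := Nat.exists_eq_add_of_le (le_trans (Nat.le_add_right m d) h)
    have := hfin' d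
    exact (AddSubgroup.eq_of_le_of_card_ge (heightSocle_anti h) (hd d')).ge

theorem IsNearlyHomogeneous.hasGeneralizedFinitePRank (hp : p.Prime) (hA : IsPPrimary p A)
    (h : IsNearlyHomogeneous p A) : HasGeneralizedFinitePRank p A := by
  rcases h with h | ⟨m, hm, hfin⟩
  · obtain ⟨κ, ⟨e⟩⟩ := h.exists_addEquiv hp hA
    exact ⟨1, fun _ => ⊤, fun _ => κ, Subsingleton.strictMono _, fun j hj => by omega,
      ⟨e.trans (AddEquiv.funUnique (Fin 1) _).symm⟩⟩
  · obtain ⟨d, hd⟩ := exists_stable_heightSocle hfin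
    obtain ⟨n, σ, ι, hσ, hσm, ⟨e⟩⟩ := exists_cocyclic_decomposition hp (1 + d) A m hA hm
      (fun x hx hy i => (mem_heightSocle.mp (hd i (mem_heightSocle.mpr
        ⟨hx, by rwa [← add_assoc] at hy⟩))).2)
    refine ⟨n, σ, ι, hσ, fun j hj => finite_index_of_finite_heightSocle hp e hfin j ?_, ⟨e⟩⟩
    -- The first exponent is at least m + 1, so every later one is at least m + 2, which puts its
    -- socle in the finite part.
    have hlt : (⟨0, by omega⟩ : Fin n) < j := hj
    have h1 := lt_of_le_of_lt (hσm ⟨0, by omega⟩) (hσ hlt)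
    have h2 := Order.add_one_le_of_lt h1
    exact_mod_cast h2

theorem HasGeneralizedFinitePRank.isNearlyHomogeneous (hp : p.Prime)
    (h : HasGeneralizedFinitePRank p A) : IsNearlyHomogeneous p A := by
  obtain ⟨n, σ, ι, hσ, hι, ⟨e⟩⟩ := h
  refine IsNearlyHomogeneous.of_addEquiv e ?_
  rcases n with _ | n
  · exact Or.inl fun x => ⟨0, Subsingleton.elim _ _⟩
  have hle : ∀ k, σ 0 ≤ σ k := fun k => hσ.monotone (Fin.zero_le k)
  rcases eq_or_ne (σ 0) ⊤ with htop | htop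
  · left
    have hdiv : ∀ k, IsPDivisible p (ι k →₀ cocyclicGroup p (σ k)) := by
      intro k
      rw [show σ k = ⊤ from top_unique (htop ▸ hle k)]
      exact (isPDivisible_cocyclicGroup_top hp).finsupp
    intro x
    choose y hy using fun k => hdiv k (x k)
    exact ⟨y, funext hy⟩
  · right
    obtain ⟨s, hs⟩ := ENat.ne_top_iff_exists.mp htop
    -- Truncated subtraction covers s = 0: the first summand is then zero, and height 0 demands
    -- nothing.
    refine ⟨s - 1, fun x hx => ?_, ?_⟩
    · rcases Nat.eq_zero_or_pos s with rfl | hpos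
      · exact ⟨x, by simp⟩
      · have hk : ∀ k, ∃ y, p ^ (s - 1) • y = x k := fun k =>
          exists_nsmul_finsupp_cocyclicGroup hp
            (by rw [Nat.sub_add_cancel hpos, hs]; exact hle k) (x k) (congrFun hx k)
        choose y hy using hk
        exact ⟨y, funext hy⟩
    · suffices hF : (heightSocle p (s - 1 + 1) ((k : Fin (n + 1)) →
          (ι k →₀ cocyclicGroup p (σ k))) : Set ((k : Fin (n + 1)) →
            (ι k →₀ cocyclicGroup p (σ k)))).Finite from hF.to_subtype
      refine (Set.Finite.pi' (t := fun k : Fin (n + 1) =>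
        {z : ι k →₀ cocyclicGroup p (σ k) | p • z = 0 ∧ (k = 0 → z = 0)}) (fun k => ?_)).subset ?_
      · by_cases hk : k = 0
        · exact (Set.finite_singleton 0).subset fun z hz => hz.2 hk
        · have := hι k (Fin.pos_iff_ne_zero.mpr hk)
          exact (finite_socle_finsupp_cocyclicGroup hp (σ k)).subset fun z hz => hz.1
      · intro x hx k
        obtain ⟨hx, y, rfl⟩ := mem_heightSocle.mp hx
        refine ⟨congrFun hx k, ?_⟩
        rintro rfl
        have hkill : ∀ τ : ℕ∞, (s : ℕ∞) = τ → ∀ z : ι 0 →₀ cocyclicGroup p τ,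
            p ^ s • z = 0 := by
          rintro _ rfl z
          exact pow_nsmul_finsupp_cocyclicGroup s z
        change p ^ (s - 1 + 1) • y 0 = 0
        rw [← Nat.add_sub_cancel' (show s ≤ s - 1 + 1 by omega), pow_add, mul_comm, mul_smul,
          hkill _ hs, smul_zero]

end Classification

/-! ### Embedded nearly homogeneous groups are summands. -/

section Summands

universe u

variable {p : ℕ} {A : Type u} [AddCommGroup A]

/-- The image of a nearly homogeneous group under an injective homomorphism into a group `X` is a
direct summand, if some homomorphism `q` satisfies `p ^ n q(A) = p ^ n X` for all `n ≥ 1`. Moreover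
`p ^ j C` is divisible for the complement `C` and some `j`. -/
theorem IsNearlyHomogeneous.exists_isCompl_range (hp : p.Prime) (hA : IsPPrimary p A)
    (h : IsNearlyHomogeneous p A) {X : Type*} [AddCommGroup X] (hX : IsPPrimary p X)
    (q φ : A →+ X) (hq : ∀ n x, ∃ a, p ^ (n + 1) • q a = p ^ (n + 1) • x)
    (hφ : Function.Injective φ) :
    ∃ C, IsCompl φ.range C ∧ ∃ j, ∀ c : C, ∃ c' : C, p ^ (j + 1) • c' = p ^ j • c := by
  have key : (∃ C, IsCompl φ.range C) ∧ ∃ j, ∀ x : X, ∃ y ∈ φ.range, ∃ x',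
      p ^ (j + 1) • x' = p ^ j • x - y := by
    rcases h with h | ⟨m, hm, hfin⟩
    · constructor
      · exact (h.of_surjective φ.rangeRestrict φ.rangeRestrict_surjective).exists_isCompl hp hX
      -- The hypothesis `hq` controls X only after one multiplication by p, hence j = 1.
      · refine ⟨1, fun x => ⟨0, zero_mem _, ?_⟩⟩
        obtain ⟨a, ha⟩ := hq 0 x
        obtain ⟨b, rfl⟩ := h a
        refine ⟨q b, ?_⟩
        rw [zero_add] at ha
        rw [sub_zero, ← ha, map_nsmul, smul_smul, ← pow_succ]
    -- Restricted to p^(m+1)A, which has finite socle, q maps onto p^(m+1)X. The counting theorem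
    -- makes the restriction of φ onto as well.
    · have hsurj : ∀ x : X, ∃ a : A, p ^ (m + 1) • φ a = p ^ (m + 1) • x := by
        let M := pMultiples (p ^ (m + 1)) A
        let N := pMultiples (p ^ (m + 1)) X
        have hmem : ∀ (f : A →+ X) (x : M), f x ∈ N := by
          rintro f ⟨_, a, rfl⟩
          exact mem_pMultiples.mpr ⟨f a, (map_nsmul f _ _).symm⟩
        let res : (A →+ X) → (M →+ N) := fun f => (f.comp M.subtype).codRestrict N (hmem f)
        have hMs : {x : M | p • x = 0}.Finite := by
          have hf : (heightSocle p (m + 1) A : Set A).Finite := Set.toFinite _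
          refine (hf.preimage (f := M.subtype) Subtype.val_injective.injOn).subset ?_
          intro x hx
          exact mem_heightSocle.mpr ⟨congrArg Subtype.val hx, mem_pMultiples.mp x.2⟩
        have hs := surjective_of_finite_socle (hA.addSubgroup M) hMs (res q) (res φ) (by
          rintro ⟨_, x, rfl⟩
          obtain ⟨a, ha⟩ := hq m x
          refine ⟨⟨p ^ (m + 1) • a, a, rfl⟩, Subtype.ext ?_⟩
          exact (map_nsmul q _ _).trans ha) (by
          intro x y hxy
          exact Subtype.ext (hφ (congrArg Subtype.val hxy)))
        intro x
        obtain ⟨⟨_, a, rfl⟩, ha⟩ := hs ⟨p ^ (m + 1) • x, x, rfl⟩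
        exact ⟨a, (map_nsmul φ _ _).symm.trans (congrArg Subtype.val ha)⟩
      constructor
      · refine exists_isCompl_of_pMultiples_le hp hX (m := m) (exists_socle_range φ hφ hm) ?_
        intro x
        obtain ⟨a, ha⟩ := hsurj x
        exact ⟨φ a, ⟨a, rfl⟩, ha⟩
      · refine ⟨m + 1, fun x => ?_⟩
        obtain ⟨a, ha⟩ := hsurj x
        exact ⟨p ^ (m + 1) • φ a, ⟨_, map_nsmul φ _ _⟩, 0, by rw [ha, sub_self, smul_zero]⟩
  obtain ⟨⟨C, hC⟩, j, hj⟩ := key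
  refine ⟨C, hC, j, fun c => ?_⟩
  obtain ⟨y, hy, x', hx'⟩ := hj c
  obtain ⟨z, hz, c', hc', rfl⟩ := AddSubgroup.mem_sup.mp
    (hC.codisjoint.eq_top ▸ AddSubgroup.mem_top x')
  refine ⟨⟨c', hc'⟩, Subtype.ext ?_⟩
  change p ^ (j + 1) • c' = p ^ j • (c : X)
  rw [← sub_eq_zero]
  refine AddSubgroup.disjoint_def.mp hC.disjoint ?_
    (sub_mem (C.nsmul_mem hc' _) (C.nsmul_mem c.2 _))
  rw [smul_add] at hx'
  rw [show p ^ (j + 1) • c' - p ^ j • (c : X) = - (p ^ (j + 1) • z + y) by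
    rw [eq_sub_iff_add_eq] at hx'
    rw [← hx']
    abel]
  exact neg_mem (add_mem (AddSubgroup.nsmul_mem _ hz _) hy)

theorem IsNearlyHomogeneous.isGeneralizedCoBassian (hp : p.Prime) (hA : IsPPrimary p A)
    (h : IsNearlyHomogeneous p A) : IsGeneralizedCoBassian A := by
  intro H φ hφ
  have hq : Function.Surjective (QuotientAddGroup.mk' H) := QuotientAddGroup.mk'_surjective H
  obtain ⟨C, hC, -⟩ := h.exists_isCompl_range hp hA (hA.of_surjective _ hq)
    (QuotientAddGroup.mk' H) φ (fun n x => by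
      obtain ⟨a, rfl⟩ := hq x
      exact ⟨a, rfl⟩) hφ
  exact ⟨C, hC⟩

end Summands

universe u

/-! ### Groups with infinite upper socle have room for a proper embedding. -/

section LargeTargets

variable {p : ℕ} {M : Type u} [AddCommGroup M]

/-- There are homomorphisms `π`, `f` from `M` to a group `T` and a subgroup `Y` of `M` such that
`π` maps `Y` onto `T`, while `f` is injective on `Y` and its image misses an element of order `p`
and height at least `j`. -/
def HasProperSelfEmbedding (p j : ℕ) (M : Type u) [AddCommGroup M] : Prop :=
  ∃ (T : Type u) (_ : AddCommGroup T) (π f : M →+ T) (Y : AddSubgroup M),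
    (∀ t, ∃ y ∈ Y, π y = t) ∧ (∀ y ∈ Y, f y = 0 → y = 0) ∧
      ∃ s : T, p • (p ^ j • s) = 0 ∧ p ^ j • s ∉ Y.map f

theorem cocyclicGen_ne_zero (hp : p.Prime) {σ : ℕ∞} (h : ((1 : ℕ) : ℕ∞) ≤ σ) :
    cocyclicGen hp σ 1 h ≠ 0 := by
  intro h0
  rw [← one_zsmul (cocyclicGen hp σ 1 h), zsmul_cocyclicGen, pow_one] at h0
  exact hp.ne_one (by exact_mod_cast Int.eq_one_of_dvd_one (by positivity) h0)

theorem nsmul_cocyclicGen_one (hp : p.Prime) {σ : ℕ∞} (h : ((1 : ℕ) : ℕ∞) ≤ σ) :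
    p • cocyclicGen hp σ 1 h = 0 := by
  rw [← natCast_zsmul, zsmul_cocyclicGen, pow_one]

theorem exists_injective_notMem_range (κ : Type*) [Infinite κ] :
    ∃ (g : κ → κ) (i : κ), Function.Injective g ∧ i ∉ Set.range g := by
  obtain ⟨e⟩ : Nonempty (Option κ ≃ κ) := by
    rw [← Cardinal.eq]
    simp
  exact ⟨fun x => e (some x), e none, fun x y h => by simpa using h, fun ⟨x, hx⟩ => by simp at hx⟩

/-- T is the infinite sum itself, and f re-indexes it by an injection of κ that misses one index; s
lives at that index. -/
theorem hasProperSelfEmbedding_of_isCompl (hp : p.Prime) {j : ℕ} {κ : Type u} [Infinite κ]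
    {σ : ℕ∞} (hσ : ((j + 1 : ℕ) : ℕ∞) ≤ σ) (θ : (κ →₀ cocyclicGroup p σ) →+ M)
    (hθ : Function.Injective θ) {C : AddSubgroup M} (hC : IsCompl θ.range C) :
    HasProperSelfEmbedding p j M := by
  have h1 : ((1 : ℕ) : ℕ∞) ≤ σ := le_trans (by exact_mod_cast Nat.le_add_left 1 j) hσ
  obtain ⟨e, he⟩ := nonempty_prod_addEquiv θ hθ hC
  obtain ⟨g, i, hg, hi⟩ := exists_injective_notMem_range κ
  let π : M →+ (κ →₀ cocyclicGroup p σ) := (AddMonoidHom.fst _ _).comp e.symm.toAddMonoidHom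
  have hπ : ∀ t, π (θ t) = t := by
    intro t
    have : e.symm (θ t) = (t, 0) := by
      rw [AddEquiv.symm_apply_eq, he, ZeroMemClass.coe_zero, add_zero]
    exact congrArg Prod.fst this
  have hs : p ^ j • Finsupp.single i (cocyclicGen hp σ (j + 1) hσ) =
      Finsupp.single i (cocyclicGen hp σ 1 h1) := by
    rw [Finsupp.smul_single, pow_nsmul_cocyclicGen hp hσ rfl]
  refine ⟨_, inferInstance, π, (Finsupp.mapDomain.addMonoidHom g).comp π, θ.range,
    fun t => ⟨θ t, ⟨t, rfl⟩, hπ t⟩, ?_, Finsupp.single i (cocyclicGen hp σ (j + 1) hσ), ?_, ?_⟩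
  · rintro _ ⟨t, rfl⟩ ht
    have ht : Finsupp.mapDomain g (π (θ t)) = 0 := ht
    rw [hπ] at ht
    rw [Finsupp.mapDomain_injective hg (ht.trans Finsupp.mapDomain_zero.symm), map_zero]
  · rw [hs, Finsupp.smul_single, nsmul_cocyclicGen_one, Finsupp.single_zero]
  · rw [hs]
    rintro ⟨y, -, hy⟩
    have hy : Finsupp.mapDomain g (π y) = _ := hy
    have := DFunLike.congr_fun hy i
    rw [Finsupp.mapDomain_of_notMem_range _ _ hi, Finsupp.single_eq_same] at this
    exact cocyclicGen_ne_zero hp h1 this.symm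

theorem infinite_of_embedding (hp : p.Prime) {κ : Type*} {σ : ℕ∞}
    (θ : (κ →₀ cocyclicGroup p σ) →+ M) (hθ : Function.Injective θ) {W : AddSubgroup M}
    (hW : ∀ x ∈ W, p • x = 0 ∧ x ∈ θ.range) (hinf : Infinite W) : Infinite κ := by
  by_contra hκ
  rw [not_infinite_iff_finite] at hκ
  refine hinf.not_finite (Set.Finite.to_subtype (s := (W : Set M)) ?_)
  refine ((finite_socle_finsupp_cocyclicGroup (p := p) hp (ι := κ) σ).image θ).subset ?_
  intro x hx
  obtain ⟨hpx, z, rfl⟩ := hW x hx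
  exact ⟨z, hθ (by rw [map_nsmul, hpx, map_zero]), rfl⟩

/-- In a relation, take the first coefficient prime to p. The earlier terms vanish and the later
ones have larger height, so v i would be higher than it is. -/
theorem isSocleIndependent_of_heights (hp : p.Prime) {n : ℕ → ℕ} (hn : StrictMono n) {v : ℕ → M}
    (hv : ∀ i, v i ∈ heightSocle p (n i) M) (hv' : ∀ i, v i ∉ heightSocle p (n i + 1) M) :
    IsSocleIndependent p v := by
  have h0 : ∀ i, p • v i = 0 := fun i => (mem_heightSocle.mp (hv i)).1
  refine ⟨h0, fun c hc i => ?_⟩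
  induction i using Nat.strong_induction_on with
  | _ i ih =>
  by_contra hi
  refine hv' i (mem_of_zsmul_mem hp _ hi (by rw [h0]; exact zero_mem _) ?_)
  have hmem : i ∈ c.support := by
    rw [Finsupp.mem_support_iff]
    rintro h
    exact hi (h ▸ dvd_zero _)
  rw [Finsupp.linearCombination_apply, Finsupp.sum, ← Finset.add_sum_erase _ _ hmem] at hc
  rw [eq_neg_of_add_eq_zero_left hc]
  refine neg_mem (sum_mem fun k hk => ?_)
  rcases lt_or_gt_of_ne (Finset.ne_of_mem_erase hk) with h | h
  · obtain ⟨b, hb⟩ := ih k h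
    rw [hb, mul_comm, mul_smul, natCast_zsmul, h0, smul_zero]
    exact zero_mem _
  · exact AddSubgroup.zsmul_mem _ (heightSocle_anti (hn h) (hv k)) _

/-- T is a countable sum of Prüfer groups, enumerated by d, and Y is generated by independent
elements y i of order p^(n i + 1), large enough to map onto d i. This gives π. The map f sends y i
to an element of the same order in coordinate i + 1, leaving coordinate 0 free for s. Both extend to
M because T is injective. -/
theorem hasProperSelfEmbedding_of_unbounded (hp : p.Prime) (j : ℕ)
    (h : ∀ n, ∃ i ≥ n, ∃ v ∈ heightSocle p i M, v ∉ heightSocle p (i + 1) M) :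
    HasProperSelfEmbedding p j M := by
  let T := ULift.{u} ℕ →₀ cocyclicGroup p (⊤ : ℕ∞)
  have hTp : IsPPrimary p T := (isPPrimary_cocyclicGroup ⊤).finsupp
  have hTd : IsPDivisible p T := (isPDivisible_cocyclicGroup_top hp).finsupp
  have hTc : Countable T := by
    have : Countable (AddCircle (1 : ℚ)) := 
      (QuotientAddGroup.mk_surjective (s := AddSubgroup.zmultiples (1 : ℚ))).countable
    infer_instance
  obtain ⟨d, hd⟩ := exists_surjective_nat T
  choose k hk using fun i => hTp (d i)
  obtain ⟨n, hn, hnP⟩ := Filter.extraction_forall_of_frequently (P := fun i m => k i ≤ m ∧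
      ∃ v ∈ heightSocle p m M, v ∉ heightSocle p (m + 1) M) (by
    intro i
    rw [Filter.frequently_atTop]
    intro a
    obtain ⟨b, hb, hv⟩ := h (max a (k i))
    exact ⟨b, le_trans (le_max_left _ _) hb, le_trans (le_max_right _ _) hb, hv⟩)
  choose hkn v hv hv' using hnP
  have hind := isSocleIndependent_of_heights hp hn hv hv'
  choose y hy using fun i => (mem_heightSocle.mp (hv i)).2
  let Φ : (ℕ →₀ ℤ) →+ M := (Finsupp.linearCombination ℤ y).toAddMonoidHom
  let Δ : (ℕ →₀ ℤ) →+ T := (Finsupp.linearCombination ℤ d).toAddMonoidHom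
  let E₀ : (ℕ →₀ ℤ) →+ (ℕ →₀ cocyclicGroup p (⊤ : ℕ∞)) := (Finsupp.linearCombination ℤ
    (fun i : ℕ => Finsupp.single i (cocyclicGen hp (⊤ : ℕ∞) (n i + 1) le_top))).toAddMonoidHom
  let s : ℕ → ULift.{u} ℕ := fun i => ⟨i + 1⟩
  have hs : Function.Injective s := fun a b hab => by simpa [s] using hab
  have hs0 : (⟨0⟩ : ULift.{u} ℕ) ∉ Set.range s := by rintro ⟨a, ha⟩; simp [s] at ha
  let E : (ℕ →₀ ℤ) →+ T := (Finsupp.mapDomain.addMonoidHom s).comp E₀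
  have hE₀ : ∀ c, E₀ c = 0 ↔ ∀ i, (p : ℤ) ^ (n i + 1) ∣ c i := by
    intro c
    rw [DFunLike.ext_iff]
    refine forall_congr' fun i => ?_
    rw [← zsmul_cocyclicGen hp (σ := (⊤ : ℕ∞)) le_top, ← linearCombination_single_apply
      (fun i => cocyclicGen hp (⊤ : ℕ∞) (n i + 1) le_top)]
    rfl
  have hΦ : ∀ c, Φ c = 0 → ∀ i, (p : ℤ) ^ (n i + 1) ∣ c i := fun c hc =>
    hind.dvd_of_linearCombination_eq_zero hp hy c hc
  obtain ⟨π, hπ⟩ := hTd.exists_comp_eq hp hTp Φ Δ (fun c hc =>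
    linearCombination_eq_zero_of_dvd (p := p) (n := fun i => n i + 1) (fun i => by
      rw [← Nat.sub_add_cancel (le_trans (hkn i) (Nat.le_add_right (n i) 1)), pow_add, mul_smul, hk,
        smul_zero]) c (hΦ c hc))
  obtain ⟨f, hf⟩ := hTd.exists_comp_eq hp hTp Φ E (fun c hc => by
    change Finsupp.mapDomain s (E₀ c) = 0
    rw [(hE₀ c).mpr (hΦ c hc), Finsupp.mapDomain_zero])
  have hS : p ^ j • Finsupp.single (⟨0⟩ : ULift.{u} ℕ) (cocyclicGen hp (⊤ : ℕ∞) (j + 1) le_top) =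
      Finsupp.single ⟨0⟩ (cocyclicGen hp ⊤ 1 le_top) := by
    rw [Finsupp.smul_single, pow_nsmul_cocyclicGen hp le_top rfl]
  refine ⟨T, inferInstance, π, f, Φ.range, fun t => ?_, ?_,
    Finsupp.single ⟨0⟩ (cocyclicGen hp ⊤ (j + 1) le_top), ?_, ?_⟩
  · obtain ⟨i, rfl⟩ := hd t
    refine ⟨Φ (Finsupp.single i 1), ⟨_, rfl⟩, ?_⟩
    rw [hπ]
    simp [Δ]
  · rintro _ ⟨c, rfl⟩ hc
    rw [hf] at hc
    have hc : Finsupp.mapDomain s (E₀ c) = 0 := hc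
    have h1 := (hE₀ c).mp (Finsupp.mapDomain_injective hs (hc.trans Finsupp.mapDomain_zero.symm))
    exact linearCombination_eq_zero_of_dvd (n := fun i => n i + 1) (fun i => by
      rw [pow_succ', mul_smul, hy, hind.1]) c h1
  · rw [hS, Finsupp.smul_single, nsmul_cocyclicGen_one, Finsupp.single_zero]
  · rw [hS]
    rintro ⟨_, ⟨c, rfl⟩, hc⟩
    rw [hf] at hc
    have hc : Finsupp.mapDomain s (E₀ c) = _ := hc
    have := DFunLike.congr_fun hc ⟨0⟩
    rw [Finsupp.mapDomain_of_notMem_range _ _ hs0, Finsupp.single_eq_same] at this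
    exact cocyclicGen_ne_zero hp le_top this.symm

theorem hasProperSelfEmbedding_of_infinite (hp : p.Prime) (hM : IsPPrimary p M) {j : ℕ}
    (hinf : Infinite (heightSocle p j M)) : HasProperSelfEmbedding p j M := by
  choose V hV hVd hVs using fun i => exists_socle_complement hp (W := heightSocle p i M)
    (heightSocle p (i + 1) M) (fun x hx => (mem_heightSocle.mp hx).1)
  -- Three cases: one height at least j carries an infinite homocyclic summand; or heights stabilise
  -- and a divisible summand of infinite rank splits off; or exact heights are unbounded.
  by_cases h1 : ∃ i ≥ j, Infinite (V i)
  · obtain ⟨i, hij, hi⟩ := h1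
    obtain ⟨κ, θ, hinj, hθ⟩ := exists_homocyclic_of_le_heightSocle hp (hV i)
    obtain ⟨C, -, hC⟩ := exists_isCompl_of_disjoint_pMultiples hp hM (m := i) (Y := θ.range)
      (exists_socle_range θ hinj (exists_nsmul_finsupp_cocyclicGroup hp le_rfl))
      (disjoint_of_socle hM fun x hx hx' hpx => AddSubgroup.disjoint_def.mp (hVd i)
        ((hθ x).mpr ⟨hpx, hx⟩) (mem_heightSocle.mpr ⟨hpx, mem_pMultiples.mp hx'⟩))
    have := infinite_of_embedding hp θ hinj (fun x hx => (hθ x).mp hx) hi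
    exact hasProperSelfEmbedding_of_isCompl hp (by exact_mod_cast Nat.succ_le_succ hij) θ hinj hC
  · by_cases h2 : ∃ n, ∀ i ≥ n, heightSocle p i M ≤ heightSocle p (i + 1) M
    · have hfinV : ∀ i ≥ j, Finite (V i) := fun i hi => by
        by_contra hc
        exact h1 ⟨i, hi, not_finite_iff_infinite.mp hc⟩
      have hU : ∀ i, Infinite (heightSocle p (j + i) M) := by
        intro i
        induction i with
        | zero => exact hinf
        | succ i ih =>
          by_contra hc
          rw [not_infinite_iff_finite] at hc
          have := hfinV (j + i) (Nat.le_add_right _ _)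
          refine ih.not_finite (Set.Finite.to_subtype
            (s := (heightSocle p (j + i) M : Set M)) ?_)
          refine ((Set.toFinite (V (j + i) : Set M)).add
            (Set.Finite.subset (s := (heightSocle p (j + (i + 1)) M : Set M)) (Set.toFinite _)
              subset_rfl)).subset ?_
          intro x hx
          obtain ⟨a, ha, b, hb, rfl⟩ := AddSubgroup.mem_sup.mp (hVs _ hx)
          exact Set.add_mem_add ha hb
      obtain ⟨n, hn⟩ := h2
      have hstab : ∀ i, heightSocle p (j + n) M ≤ heightSocle p (j + n + i) M := by
        intro i
        induction i with
        | zero => exact le_rfl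
        | succ i ih => exact ih.trans (hn _ (by omega))
      let D := pMultiples (p ^ (j + n)) M
      have hDp : IsPPrimary p D := hM.addSubgroup D
      have hDd : IsPDivisible p D := by
        refine hDp.isPDivisible_of_socle ?_
        rintro ⟨x, hx⟩ hpx i
        obtain ⟨y, hy⟩ := (mem_heightSocle.mp (hstab i (mem_heightSocle.mpr
          ⟨congrArg Subtype.val hpx, mem_pMultiples.mp hx⟩))).2
        refine ⟨⟨p ^ (j + n) • y, y, rfl⟩, Subtype.ext ?_⟩
        change p ^ i • (p ^ (j + n) • y) = x
        rw [smul_smul, ← pow_add, add_comm]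
        exact hy
      obtain ⟨κ, θ, hinj, hθ⟩ := exists_divisible_of_le_socle hp hDp hDd
        (W := (nsmulAddMonoidHom p : D →+ D).ker) (fun x hx => hx)
      let θ' := D.subtype.comp θ
      have hinj' : Function.Injective θ' := D.subtype_injective.comp hinj
      have := infinite_of_embedding hp θ' hinj' (W := heightSocle p (j + n) M) (by
        intro x hx
        obtain ⟨hpx, hxD⟩ := mem_heightSocle.mp hx
        refine ⟨hpx, ?_⟩
        obtain ⟨t, ht⟩ := ((hθ ⟨x, mem_pMultiples.mpr hxD⟩).mp (Subtype.ext hpx)).2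
        exact ⟨t, congrArg Subtype.val ht⟩) (hU n)
      obtain ⟨C, hC⟩ := ((isPDivisible_cocyclicGroup_top hp).finsupp.of_surjective _
        θ'.rangeRestrict_surjective).exists_isCompl hp hM
      exact hasProperSelfEmbedding_of_isCompl hp le_top θ' hinj' hC
    · push Not at h2
      refine hasProperSelfEmbedding_of_unbounded hp j fun n => ?_
      obtain ⟨i, hi, hle⟩ := h2 n
      exact ⟨i, hi, SetLike.not_le_iff_exists.mp hle⟩

end LargeTargets

/-! ### Replacing quotients by surjections. -/

section Transfer

variable {A X : Type*} [AddCommGroup A] [AddCommGroup X]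

theorem IsDirectSummand.map {B : Type*} [AddCommGroup B] {S : AddSubgroup B}
    (hS : IsDirectSummand S) (e : B ≃+ X) : IsDirectSummand (S.map e.toAddMonoidHom) := by
  obtain ⟨D, hD⟩ := hS
  exact ⟨D.map e.toAddMonoidHom, e.mapAddSubgroup.isCompl hD⟩

theorem map_range_symm_comp {B : Type*} [AddCommGroup B] (e : B ≃+ X) (φ : A →+ X) :
    (e.symm.toAddMonoidHom.comp φ).range.map e.toAddMonoidHom = φ.range := by
  ext x
  simp [AddMonoidHom.mem_range]

theorem IsGeneralizedCoBassian.isDirectSummand_range (hA : IsGeneralizedCoBassian A)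
    (q φ : A →+ X) (hq : Function.Surjective q) (hφ : Function.Injective φ) :
    IsDirectSummand φ.range := by
  let e := QuotientAddGroup.quotientKerEquivOfSurjective q hq
  have := (hA q.ker (e.symm.toAddMonoidHom.comp φ) (e.symm.injective.comp hφ)).map e
  rwa [map_range_symm_comp] at this

theorem IsSemiGeneralizedCoBassian.exists_isEssentialIn (hA : IsSemiGeneralizedCoBassian A)
    (q φ : A →+ X) (hq : Function.Surjective q) (hφ : Function.Injective φ) :
    ∃ S : AddSubgroup X, IsDirectSummand S ∧ IsEssentialIn φ.range S := by
  let e := QuotientAddGroup.quotientKerEquivOfSurjective q hq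
  obtain ⟨S, hS, hle, hess⟩ := hA q.ker (e.symm.toAddMonoidHom.comp φ) (e.symm.injective.comp hφ)
  refine ⟨S.map e.toAddMonoidHom, hS.map e, ?_, ?_⟩
  · rw [← map_range_symm_comp e φ]
    exact AddSubgroup.map_mono hle
  · intro Z hZ hZ0 hbot
    refine hess (Z.map e.symm.toAddMonoidHom) ?_ ?_ ?_
    · rintro _ ⟨z, hz, rfl⟩
      obtain ⟨s, hs, rfl⟩ := hZ hz
      simpa using hs
    · intro h
      refine hZ0 ((AddSubgroup.eq_bot_iff_forall _).mpr fun z hz => ?_)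
      have : e.symm z ∈ Z.map e.symm.toAddMonoidHom := ⟨z, hz, rfl⟩
      rw [h, AddSubgroup.mem_bot] at this
      simpa using this
    · rw [eq_bot_iff]
      rintro _ ⟨⟨a, rfl⟩, z, hz, hza⟩
      have hza : e.symm z = e.symm (φ a) := hza
      have hz' : z = φ a := e.symm.injective hza
      have : φ a ∈ φ.range ⊓ Z := ⟨⟨a, rfl⟩, hz' ▸ hz⟩
      rw [hbot, AddSubgroup.mem_bot] at this
      rw [AddSubgroup.mem_bot, AddMonoidHom.comp_apply, this, map_zero]

theorem IsEssentialIn.mem_of_nsmul_eq_zero {p : ℕ} (hp : p.Prime) {S T : AddSubgroup X}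
    (h : IsEssentialIn S T) {x : X} (hx : x ∈ T) (hpx : p • x = 0) : x ∈ S := by
  by_cases h0 : x = 0
  · rw [h0]
    exact zero_mem _
  have h1 := h.2 (AddSubgroup.zmultiples x) ((AddSubgroup.zmultiples_le_of_mem hx))
    (by simpa using h0)
  obtain ⟨⟨_, hyS, n, rfl⟩, hy0⟩ := AddSubgroup.ne_bot_iff_exists_ne_zero.mp h1
  refine mem_of_zsmul_mem hp S (n := n) ?_ (by rw [hpx]; exact zero_mem _) hyS
  rintro ⟨b, rfl⟩
  refine hy0 (Subtype.ext ?_)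
  change ((p : ℤ) * b) • x = 0
  rw [mul_comm, mul_smul, natCast_zsmul, hpx, smul_zero]

end Transfer

/-! ### Necessity: embeddings that raise a height. -/

section Obstruction

variable {p : ℕ} {A : Type u} [AddCommGroup A]

/-- If `w` in the socle has height exactly `k` and the elements of larger height in the socle are
infinitely many, some embedding of `A` in one of its quotients increases the height of `w`. The
homomorphisms `β` and `ρ` detect that this embedding is not essential in a summand. -/
theorem exists_height_increasing_embedding (hp : p.Prime) (hA : IsPPrimary p A) {k : ℕ} {w : A}
    (hw : p • w = 0) (hwk : ∃ y, p ^ k • y = w) (hwk' : ¬ ∃ y, p ^ (k + 1) • y = w)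
    (hinf : Infinite (heightSocle p (k + 1) A)) :
    ∃ (X : Type u) (_ : AddCommGroup X) (q φ : A →+ X),
      Function.Surjective q ∧ Function.Injective φ ∧ (∃ x, φ w = p ^ (k + 1) • x) ∧
        ∃ (β : A →+ cocyclicGroup p ((k + 1 : ℕ) : ℕ∞))
          (ρ : X →+ cocyclicGroup p ((k + 1 : ℕ) : ℕ∞)),
          (∀ a, ρ (φ a) = p • β a) ∧ (∀ x, ∃ z, ρ x = p • z) ∧ β w ≠ 0 := by
  obtain ⟨b, hb⟩ := hwk
  let Z := cocyclicGroup p ((k + 1 : ℕ) : ℕ∞)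
  have h1 : ((1 : ℕ) : ℕ∞) ≤ ((k + 1 : ℕ) : ℕ∞) := by exact_mod_cast Nat.le_add_left 1 k
  have hw0 : ∀ n : ℤ, n • w ∈ pMultiples (p ^ (k + 1)) A → (p : ℤ) ∣ n := by
    intro n hn
    by_contra hpn
    exact hwk' (mem_pMultiples.mp (mem_of_zsmul_mem hp _ hpn (by rw [hw]; exact zero_mem _) hn))
  have hind : IsSocleIndependent p (fun _ : Unit => w) := by
    refine ⟨fun _ => hw, fun c hc i => hw0 _ ?_⟩
    have : c = Finsupp.single () (c ()) := by ext; simp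
    rw [this, Finsupp.linearCombination_single] at hc
    rw [show c i = c () from rfl, hc]
    exact zero_mem _
  obtain ⟨θ₀, hθ₀, hθ₀w⟩ := exists_homocyclic_embedding hp hind (fun _ => hb)
  let θ : Z →+ A := θ₀.comp (Finsupp.singleAddHom ())
  have hθ : Function.Injective θ := hθ₀.comp (Finsupp.single_injective ())
  have hθw : θ (cocyclicGen hp _ 1 h1) = w := hθ₀w ()
  obtain ⟨M, hM, hcompl⟩ := exists_isCompl_of_disjoint_pMultiples hp hA (m := k) (Y := θ.range)
    (exists_socle_range θ hθ (exists_nsmul_cocyclicGroup hp le_rfl))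
    (disjoint_of_socle hA (by
      rintro _ ⟨z, rfl⟩ hz hpz
      obtain ⟨n, rfl⟩ := exists_zsmul_cocyclicGen hp h1 z
        (hθ (by rw [map_nsmul, pow_one, hpz, map_zero]))
      rw [map_zsmul, hθw] at hz ⊢
      obtain ⟨m, rfl⟩ := hw0 n hz
      rw [mul_comm, mul_smul, natCast_zsmul, hw, smul_zero]))
  obtain ⟨e, he⟩ := nonempty_prod_addEquiv θ hθ hcompl
  have hinfM : Infinite (heightSocle p (k + 1) M) := by
    have hmem : ∀ x : heightSocle p (k + 1) A, (x : A) ∈ M := fun x =>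
      hM (mem_pMultiples.mpr (mem_heightSocle.mp x.2).2)
    refine Infinite.of_injective (β := heightSocle p (k + 1) A)
      (α := heightSocle p (k + 1) M)
      (fun x => ⟨⟨x, hmem x⟩, ?_⟩) ?_
    · obtain ⟨hpx, a, ha⟩ := mem_heightSocle.mp x.2
      refine mem_heightSocle.mpr ⟨Subtype.ext hpx, ?_⟩
      obtain ⟨⟨z, m⟩, rfl⟩ := e.surjective a
      refine ⟨m, Subtype.ext ?_⟩
      change p ^ (k + 1) • (m : A) = x
      rw [← ha, he, smul_add, ← map_nsmul, pow_nsmul_cocyclicGroup, map_zero, zero_add]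
    · intro x y hxy
      have h := congrArg (fun z : heightSocle p (k + 1) M => ((z : M) : A)) hxy
      exact Subtype.ext h
  obtain ⟨T, _, π, f, Y, hπ, hf, s, hps, hs⟩ :=
    hasProperSelfEmbedding_of_infinite hp (hA.addSubgroup M) hinfM
  -- The generator of Z goes to p s, so that its multiple of order p, which corresponds to w, goes
  -- to p^(k+1) s.
  obtain ⟨g, hg⟩ := exists_comp_eq_of_surjective
    (zmultiplesHom Z (cocyclicGen hp ((k + 1 : ℕ) : ℕ∞) (k + 1) le_rfl))
    (fun z => exists_zsmul_cocyclicGen hp le_rfl z (pow_nsmul_cocyclicGroup (k + 1) z))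
    (zmultiplesHom T (p • s)) (fun n hn => by
      obtain ⟨m, rfl⟩ := (zsmul_cocyclicGen hp le_rfl n).mp hn
      change ((p : ℤ) ^ (k + 1) * m) • p • s = 0
      rw [mul_comm, mul_smul, show ((p : ℤ) ^ (k + 1)) • p • s = p • (p ^ (k + 1) • s) by
        rw [smul_comm, ← natCast_zsmul s (p ^ (k + 1))]
        push_cast
        rfl, hps, smul_zero])
  have hg1 : g (cocyclicGen hp _ 1 h1) = p ^ (k + 1) • s := by
    have h2 := hg 1
    rw [zmultiplesHom_apply, one_smul, zmultiplesHom_apply, one_smul] at h2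
    rw [← pow_nsmul_cocyclicGen hp (i := k) (k := 1) le_rfl rfl, map_nsmul, h2, smul_smul,
      ← pow_succ]
  let P := (nsmulAddMonoidHom p : Z →+ Z)
  let fst : Z × M →+ Z := AddMonoidHom.fst Z M
  let snd : Z × M →+ M := AddMonoidHom.snd Z M
  let q₀ : Z × M →+ P.range × T × (M ⧸ Y) := (P.rangeRestrict.comp fst).prod
    ((π.comp snd).prod ((QuotientAddGroup.mk' Y).comp snd))
  -- The first coordinate p z forgets just the socle of Z, which is recovered in T because p^(k+1) s
  -- lies outside f(Y). The saved factor p is what makes the first coordinate useful to `ρ`.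
  let φ₀ : Z × M →+ P.range × T × (M ⧸ Y) := (P.rangeRestrict.comp fst).prod
    ((g.comp fst + f.comp snd).prod ((QuotientAddGroup.mk' Y).comp snd))
  have hq₀ : Function.Surjective q₀ := by
    rintro ⟨⟨_, z, rfl⟩, t, m⟩
    obtain ⟨m, rfl⟩ := QuotientAddGroup.mk'_surjective Y m
    obtain ⟨y, hy, hyt⟩ := hπ (t - π m)
    refine ⟨(z, m + y), Prod.ext rfl (Prod.ext ?_ ?_)⟩
    · change π (m + y) = t
      rw [map_add, hyt, add_sub_cancel]
    · change QuotientAddGroup.mk' Y (m + y) = QuotientAddGroup.mk' Y m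
      rw [map_add, (QuotientAddGroup.eq_zero_iff (N := Y) y).mpr hy |> fun h =>
        (show QuotientAddGroup.mk' Y y = 0 from h), add_zero]
  have hφ₀ : Function.Injective φ₀ := by
    rw [injective_iff_map_eq_zero]
    rintro ⟨z, m⟩ hzm
    have e1 : p • z = 0 := congrArg Subtype.val (congrArg Prod.fst hzm)
    have e2 : g z + f m = 0 := congrArg (fun x => x.2.1) hzm
    have e3 : m ∈ Y := (QuotientAddGroup.eq_zero_iff m).mp (congrArg (fun x => x.2.2) hzm)
    obtain ⟨n, rfl⟩ := exists_zsmul_cocyclicGen hp h1 z (by rwa [pow_one])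
    have hpn : (p : ℤ) ∣ n := by
      by_contra hpn
      refine hs (mem_of_zsmul_mem hp _ hpn (by rw [hps]; exact zero_mem _) ?_)
      rw [map_zsmul, hg1] at e2
      rw [eq_neg_of_add_eq_zero_left e2]
      exact neg_mem ⟨m, e3, rfl⟩
    have hz : n • cocyclicGen hp ((k + 1 : ℕ) : ℕ∞) 1 h1 = 0 :=
      (zsmul_cocyclicGen hp h1 n).mpr (by rwa [pow_one])
    rw [hz, map_zero, zero_add] at e2
    rw [hz, hf m e3 e2]
    rfl
  have hew : e.symm w = (cocyclicGen hp _ 1 h1, 0) := by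
    rw [AddEquiv.symm_apply_eq, he, hθw, ZeroMemClass.coe_zero, add_zero]
  refine ⟨_, inferInstance, q₀.comp e.symm.toAddMonoidHom, φ₀.comp e.symm.toAddMonoidHom,
    hq₀.comp e.symm.surjective, hφ₀.comp e.symm.injective, ⟨(0, s, 0), ?_⟩,
    fst.comp e.symm.toAddMonoidHom, P.range.subtype.comp (AddMonoidHom.fst _ _), fun _ => rfl,
    ?_, ?_⟩
  · change φ₀ (e.symm w) = _
    rw [hew]
    refine Prod.ext (Subtype.ext ?_) (Prod.ext ?_ ?_)
    · change p • cocyclicGen hp _ 1 h1 = ((p ^ (k + 1) • (0 : P.range) : P.range) : Z)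
      rw [nsmul_cocyclicGen_one, smul_zero]
      rfl
    · change g (cocyclicGen hp _ 1 h1) + f 0 = p ^ (k + 1) • s
      rw [hg1, map_zero, add_zero]
    · change QuotientAddGroup.mk' Y 0 = p ^ (k + 1) • (0 : M ⧸ Y)
      rw [map_zero, smul_zero]
  · rintro ⟨⟨_, z, rfl⟩, _⟩
    exact ⟨z, rfl⟩
  · change (e.symm w).1 ≠ 0
    rw [hew]
    exact cocyclicGen_ne_zero hp h1

theorem IsGeneralizedCoBassian.finite_heightSocle (hp : p.Prime) (hA : IsPPrimary p A)
    (h : IsGeneralizedCoBassian A) {k : ℕ} {w : A} (hw : p • w = 0) (hwk : ∃ y, p ^ k • y = w)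
    (hwk' : ¬ ∃ y, p ^ (k + 1) • y = w) : Finite (heightSocle p (k + 1) A) := by
  by_contra hinf
  obtain ⟨X, _, q, φ, hq, hφ, ⟨x, hx⟩, -⟩ :=
    exists_height_increasing_embedding hp hA hw hwk hwk' (not_finite_iff_infinite.mp hinf)
  obtain ⟨D, hD⟩ := h.isDirectSummand_range q φ hq hφ
  obtain ⟨_, ⟨a, rfl⟩, d, hd, rfl⟩ := AddSubgroup.mem_sup.mp
    (hD.codisjoint.eq_top ▸ AddSubgroup.mem_top x)
  refine hwk' ⟨a, hφ ?_⟩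
  rw [← sub_eq_zero]
  refine AddSubgroup.disjoint_def.mp hD.disjoint (sub_mem ⟨_, rfl⟩ ⟨_, rfl⟩) ?_
  rw [hx, map_nsmul, smul_add, sub_add_cancel_left]
  exact neg_mem (D.nsmul_mem hd _)

theorem IsSemiGeneralizedCoBassian.finite_heightSocle (hp : p.Prime) (hA : IsPPrimary p A)
    (h : IsSemiGeneralizedCoBassian A) {k : ℕ} {w : A} (hw : p • w = 0)
    (hwk : ∃ y, p ^ (k + 1) • y = w) (hwk' : ¬ ∃ y, p ^ (k + 1 + 1) • y = w) :
    Finite (heightSocle p (k + 1 + 1) A) := by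
  by_contra hinf
  obtain ⟨X, _, q, φ, hq, hφ, ⟨x, hx⟩, β, ρ, hρ, hρ', hβ⟩ :=
    exists_height_increasing_embedding hp hA hw hwk hwk' (not_finite_iff_infinite.mp hinf)
  obtain ⟨S, ⟨D, hD⟩, hS⟩ := h.exists_isEssentialIn q φ hq hφ
  obtain ⟨s, hs, d, hd, rfl⟩ := AddSubgroup.mem_sup.mp
    (hD.codisjoint.eq_top ▸ AddSubgroup.mem_top x)
  have hφw : φ w = p ^ (k + 1 + 1) • s := by
    rw [← sub_eq_zero]
    refine AddSubgroup.disjoint_def.mp hD.disjoint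
      (sub_mem (hS.1 ⟨_, rfl⟩) (S.nsmul_mem hs _)) ?_
    rw [hx, smul_add, add_sub_cancel_left]
    exact D.nsmul_mem hd _
  obtain ⟨b, hb⟩ := hwk
  -- This element of S has order dividing p, so essentiality puts it in the image as φ c with p c =
  -- 0. Then ρ(φ c) = β(p c) = 0, whereas computing ρ directly gives β w, since p^(k+2) kills the
  -- target.
  obtain ⟨c, hc⟩ := hS.mem_of_nsmul_eq_zero hp (x := p ^ k • (φ b - p • s))
    (S.nsmul_mem (sub_mem (hS.1 ⟨_, rfl⟩) (S.nsmul_mem hs _)) _) (by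
      rw [smul_smul, ← pow_succ', smul_sub, ← map_nsmul, hb, hφw, smul_smul, ← pow_succ, sub_self])
  have hpc : p • c = 0 := hφ (by
    rw [map_nsmul, hc, map_zero, smul_smul, ← pow_succ', smul_sub, ← map_nsmul, hb, hφw,
      smul_smul, ← pow_succ, sub_self])
  obtain ⟨z, hz⟩ := hρ' s
  refine hβ ?_
  have h1 : ρ (φ c) = 0 := by rw [hρ, ← map_nsmul, hpc, map_zero]
  rw [hc, map_nsmul, map_sub, hρ, map_nsmul, hz, ← smul_sub, smul_smul, ← pow_succ, smul_sub,
    smul_smul, ← pow_succ, pow_nsmul_cocyclicGroup, sub_zero, ← map_nsmul, hb] at h1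
  exact h1

theorem IsGeneralizedCoBassian.isNearlyHomogeneous (hp : p.Prime) (hA : IsPPrimary p A)
    (h : IsGeneralizedCoBassian A) : IsNearlyHomogeneous p A := by
  classical
  by_cases hall : ∀ i, ∀ x : A, p • x = 0 → ∃ y, p ^ i • y = x
  · exact Or.inl (hA.isPDivisible_of_socle fun x hx i => hall i x hx)
  · push Not at hall
    obtain ⟨w, hw, hwk⟩ := Nat.find_spec hall
    obtain ⟨k, hk⟩ : ∃ k, Nat.find hall = k + 1 := by
      refine Nat.exists_eq_succ_of_ne_zero fun h0 => hwk w ?_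
      rw [h0, pow_zero, one_smul]
    have hmin := Nat.find_min hall (m := k) (by omega)
    push Not at hmin
    rw [hk] at hwk
    exact Or.inr ⟨k, hmin, h.finite_heightSocle hp hA hw (hmin w hw) (by simpa using hwk)⟩

/-- Heights in pA are one less than in A, so the first failing height in pA is a positive exact
height in A, as the obstruction requires. -/
theorem IsSemiGeneralizedCoBassian.isNearlyHomogeneous (hp : p.Prime) (hA : IsPPrimary p A)
    (h : IsSemiGeneralizedCoBassian A) : IsNearlyHomogeneous p (pMultiples p A) := by
  classical
  by_cases hall : ∀ i, ∀ x : A, p • x = 0 → (∃ y, p • y = x) → ∃ y, p ^ (i + 1) • y = x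
  · refine Or.inl ((hA.addSubgroup _).isPDivisible_of_socle ?_)
    rintro ⟨x, hx⟩ hpx i
    obtain ⟨y, hy⟩ := hall i x (congrArg Subtype.val hpx) (mem_pMultiples.mp hx)
    refine ⟨⟨p • y, y, rfl⟩, Subtype.ext ?_⟩
    change p ^ i • (p • y) = x
    rw [smul_smul, ← pow_succ, hy]
  · push Not at hall
    obtain ⟨w, hw, hwp, hwk⟩ := Nat.find_spec hall
    obtain ⟨k, hk⟩ : ∃ k, Nat.find hall = k + 1 := by
      refine Nat.exists_eq_succ_of_ne_zero fun h0 => ?_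
      obtain ⟨y, hy⟩ := hwp
      exact hwk y (by rw [h0, zero_add, pow_one, hy])
    have hmin := Nat.find_min hall (m := k) (by omega)
    push Not at hmin
    rw [hk] at hwk
    have hfin := h.finite_heightSocle hp hA hw (hmin w hw hwp) (by simpa using hwk)
    refine Or.inr ⟨k, ?_, ?_⟩
    · rintro ⟨x, hx⟩ hpx
      obtain ⟨y, hy⟩ := hmin x (congrArg Subtype.val hpx) (mem_pMultiples.mp hx)
      refine ⟨⟨p • y, y, rfl⟩, Subtype.ext ?_⟩
      change p ^ k • (p • y) = x
      rw [smul_smul, ← pow_succ, hy]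
    · refine Finite.of_injective (β := heightSocle p (k + 1 + 1) A) (fun x => ⟨x, ?_⟩) ?_
      · obtain ⟨hpx, ⟨_, y, rfl⟩, hy⟩ := mem_heightSocle.mp x.2
        refine mem_heightSocle.mpr ⟨congrArg Subtype.val hpx, y, ?_⟩
        rw [pow_succ, mul_smul]
        exact congrArg Subtype.val hy
      · intro x y hxy
        have h := congrArg (fun z : heightSocle p (k + 1 + 1) A => (z : A)) hxy
        exact Subtype.ext (Subtype.ext h)

end Obstruction

/-! ### Subgroups of the socle as socles of summands. -/

section Subsocles

variable {p : ℕ}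

theorem isCompl_sup_map {C : Type*} [AddCommGroup C] {Y C' : AddSubgroup C} (h : IsCompl Y C')
    {S S' : AddSubgroup C'} (hS : IsCompl S S') :
    IsCompl (Y ⊔ S.map C'.subtype) (S'.map C'.subtype) := by
  refine ⟨?_, codisjoint_iff.mpr (top_unique fun x _ => ?_)⟩
  · rw [AddSubgroup.disjoint_def]
    rintro _ hx ⟨s', hs', rfl⟩
    obtain ⟨y, hy, _, ⟨s, hs, rfl⟩, hys⟩ := AddSubgroup.mem_sup.mp hx
    have hys : y + (s : C) = s' := hys
    have hy0 : y = 0 := AddSubgroup.disjoint_def.mp h.disjoint hy (by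
      rw [eq_sub_of_add_eq hys]
      exact sub_mem s'.2 s.2)
    rw [hy0, zero_add] at hys
    have := AddSubgroup.disjoint_def.mp hS.disjoint hs (Subtype.ext hys ▸ hs')
    change (s' : C) = 0
    rw [← hys, this]
    rfl
  · obtain ⟨y, hy, c, hc, rfl⟩ := AddSubgroup.mem_sup.mp
      (h.codisjoint.eq_top ▸ AddSubgroup.mem_top x)
    obtain ⟨s, hs, s', hs', hss⟩ := AddSubgroup.mem_sup.mp
      (hS.codisjoint.eq_top ▸ AddSubgroup.mem_top (⟨c, hc⟩ : C'))
    have hss : (s : C) + s' = c := congrArg Subtype.val hss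
    rw [← hss, ← add_assoc]
    exact AddSubgroup.add_mem_sup (AddSubgroup.add_mem_sup hy ⟨s, hs, rfl⟩) ⟨s', hs', rfl⟩

theorem mem_sup_map_socle {C : Type*} [AddCommGroup C] {Y C' : AddSubgroup C} (h : IsCompl Y C')
    {S : AddSubgroup C'} {x : C} (hx : x ∈ Y ⊔ S.map C'.subtype) (hpx : p • x = 0) :
    ∃ y ∈ Y, ∃ s ∈ S, p • y = 0 ∧ p • s = 0 ∧ y + s = x := by
  obtain ⟨y, hy, _, ⟨s, hs, rfl⟩, rfl⟩ := AddSubgroup.mem_sup.mp hx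
  have h0 : p • y + p • (s : C) = 0 := by rw [← smul_add]; exact hpx
  have hy0 : p • y = 0 := AddSubgroup.disjoint_def.mp h.disjoint (Y.nsmul_mem hy _) (by
    rw [eq_neg_of_add_eq_zero_left h0]
    exact neg_mem (C'.nsmul_mem s.2 _))
  rw [hy0, zero_add] at h0
  exact ⟨y, hy, s, hs, hy0, Subtype.ext h0, rfl⟩

/-- The subgroup `N` is the socle of a direct summand. -/
def IsSocleOfSummand (p : ℕ) {C : Type*} [AddCommGroup C] (N : AddSubgroup C) : Prop :=
  ∃ S : AddSubgroup C, IsDirectSummand S ∧ ∀ x, x ∈ N ↔ p • x = 0 ∧ x ∈ S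

theorem IsSocleOfSummand.of_isCompl {C : Type*} [AddCommGroup C] {N Y C' : AddSubgroup C}
    (hN : ∀ x ∈ N, p • x = 0) (h : IsCompl Y C') (hY : ∀ x ∈ Y, p • x = 0 → x ∈ N)
    (h' : IsSocleOfSummand p (N.addSubgroupOf C'))
    (hproj : ∀ y ∈ Y, ∀ c ∈ C', y + c ∈ N → p • y = 0) : IsSocleOfSummand p N := by
  obtain ⟨S, ⟨S', hS⟩, hS'⟩ := h'
  refine ⟨_, ⟨_, isCompl_sup_map h hS⟩, fun x => ⟨fun hx => ⟨hN x hx, ?_⟩, ?_⟩⟩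
  · obtain ⟨y, hy, c, hc, rfl⟩ := AddSubgroup.mem_sup.mp
      (h.codisjoint.eq_top ▸ AddSubgroup.mem_top x)
    have hcN : c ∈ N := by
      simpa using sub_mem hx (hY y hy (hproj y hy c hc hx))
    exact AddSubgroup.add_mem_sup hy ⟨⟨c, hc⟩,
      ((hS' ⟨c, hc⟩).mp (AddSubgroup.mem_addSubgroupOf.mpr hcN)).2, rfl⟩
  · rintro ⟨hpx, hx⟩
    obtain ⟨y, hy, s, hs, hpy, hps, rfl⟩ := mem_sup_map_socle h hx hpx
    exact add_mem (hY y hy hpy) (AddSubgroup.mem_addSubgroupOf.mp ((hS' s).mpr ⟨hps, hs⟩))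

theorem nsmul_eq_zero_of_add {C : Type*} [AddCommGroup C] {Y C' : AddSubgroup C}
    (h : IsCompl Y C') {y c : C} (hy : y ∈ Y) (hc : c ∈ C') (hyc : p • (y + c) = 0) :
    p • y = 0 := by
  refine AddSubgroup.disjoint_def.mp h.disjoint (Y.nsmul_mem hy _) ?_
  rw [smul_add] at hyc
  rw [eq_neg_of_add_eq_zero_left hyc]
  exact neg_mem (C'.nsmul_mem hc _)

/-- Induction on the height bound: the elements of N of the top height j carry a homocyclic summand
of exponent p^(j+1), and in its complement the rest of N avoids height j. -/
theorem isSocleOfSummand_of_disjoint (hp : p.Prime) (j : ℕ) :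
    ∀ (C : Type u) [AddCommGroup C] (N : AddSubgroup C), IsPPrimary p C →
      (∀ x ∈ N, p • x = 0) → Disjoint N (pMultiples (p ^ j) C) → IsSocleOfSummand p N := by
  induction j with
  | zero =>
    intro C _ N _ _ hd
    refine ⟨⊥, ⟨⊤, isCompl_bot_top⟩, fun x => ⟨fun hx => ?_, fun hx => ?_⟩⟩
    · rw [AddSubgroup.disjoint_def.mp hd hx (mem_pMultiples.mpr ⟨x, by simp⟩)]
      simp
    · rw [AddSubgroup.mem_bot.mp hx.2]
      exact zero_mem _
  | succ j ih =>
    intro C _ N hC hN hd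
    obtain ⟨κ, θ, hinj, hθ⟩ := exists_homocyclic_of_le_heightSocle hp (j := j)
      (W := N ⊓ pMultiples (p ^ j) C)
      (fun x hx => mem_heightSocle.mpr ⟨hN x hx.1, mem_pMultiples.mp hx.2⟩)
    obtain ⟨C', -, hC'⟩ := exists_isCompl_of_disjoint_pMultiples hp hC (m := j) (Y := θ.range)
      (exists_socle_range θ hinj (exists_nsmul_finsupp_cocyclicGroup hp le_rfl))
      (disjoint_of_socle hC fun x hx hx' hpx => AddSubgroup.disjoint_def.mp hd
        ((hθ x).mpr ⟨hpx, hx⟩).1 hx')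
    refine IsSocleOfSummand.of_isCompl hN hC' (fun x hx hpx => ((hθ x).mpr ⟨hpx, hx⟩).1)
      (ih C' _ (hC.addSubgroup C') (fun x hx => Subtype.ext (hN x hx)) ?_)
      (fun y hy c hc hyc => nsmul_eq_zero_of_add hC' hy hc (hN _ hyc))
    rw [AddSubgroup.disjoint_def]
    rintro x hxN hx
    obtain ⟨y, rfl⟩ := mem_pMultiples.mp hx
    exact Subtype.ext (AddSubgroup.disjoint_def.mp hC'.disjoint
      ((hθ _).mp ⟨hxN, mem_pMultiples.mpr ⟨y, rfl⟩⟩).2 (p ^ j • y).2)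

/-- If `p ^ j C` is divisible, then every subgroup of the socle of `C` is the socle of a direct
summand. -/
theorem isSocleOfSummand (hp : p.Prime) {C : Type u} [AddCommGroup C] (hC : IsPPrimary p C)
    {j : ℕ} (hj : ∀ c : C, ∃ c', p ^ (j + 1) • c' = p ^ j • c) {N : AddSubgroup C}
    (hN : ∀ x ∈ N, p • x = 0) : IsSocleOfSummand p N := by
  let D := pMultiples (p ^ j) C
  have hD : IsPDivisible p D := by
    rintro ⟨_, c, rfl⟩
    obtain ⟨c', hc'⟩ := hj c
    refine ⟨⟨p ^ j • c', c', rfl⟩, Subtype.ext ?_⟩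
    change p • (p ^ j • c') = p ^ j • c
    rw [smul_smul, ← pow_succ', hc']
  obtain ⟨κ, θ, hinj, hθ⟩ := exists_divisible_of_le_socle hp (hC.addSubgroup D) hD
    (W := N.addSubgroupOf D) (fun x hx => Subtype.ext (hN x hx))
  let θ' := D.subtype.comp θ
  have hθ' : ∀ x ∈ θ'.range, p • x = 0 → x ∈ N := by
    rintro _ ⟨t, rfl⟩ hpx
    exact AddSubgroup.mem_addSubgroupOf.mp ((hθ (θ t)).mpr ⟨Subtype.ext hpx, t, rfl⟩)
  obtain ⟨C', hC'⟩ := ((isPDivisible_cocyclicGroup_top hp).finsupp.of_surjective _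
    θ'.rangeRestrict_surjective).exists_isCompl hp hC
  refine IsSocleOfSummand.of_isCompl hN hC' hθ' (isSocleOfSummand_of_disjoint hp j C' _
    (hC.addSubgroup C') (fun x hx => Subtype.ext (hN x hx)) ?_)
    (fun y hy c hc hyc => nsmul_eq_zero_of_add hC' hy hc (hN _ hyc))
  rw [AddSubgroup.disjoint_def]
  rintro x hxN hx
  obtain ⟨y, rfl⟩ := mem_pMultiples.mp hx
  obtain ⟨t, ht⟩ := ((hθ ⟨p ^ j • (y : C), y, rfl⟩).mp hxN).2
  exact Subtype.ext (AddSubgroup.disjoint_def.mp hC'.disjoint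
    (x := p ^ j • (y : C)) ⟨t, congrArg Subtype.val ht⟩ (p ^ j • y).2)

end Subsocles

/-! ### Sufficiency for the semi-generalized property, and the conclusion. -/

section Main

variable {p : ℕ} {G : Type u} [AddCommGroup G]

theorem IsNearlyHomogeneous.of_pMultiples (hG : IsPPrimary p G) {C : AddSubgroup G}
    (hC : ∀ x : C, p • x = 0 → ∃ y : C, p • y = x)
    (hpC : ∀ g : G, ∃ c : C, p • (c : G) = p • g)
    (h : IsNearlyHomogeneous p (pMultiples p G)) : IsNearlyHomogeneous p C := by
  rcases h with h | ⟨m, hm, hfin⟩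
  · refine Or.inl ((hG.addSubgroup C).isPDivisible_of_socle fun x hx i => ?_)
    obtain ⟨y, rfl⟩ := hC x hx
    obtain ⟨⟨_, g, rfl⟩, hg⟩ := h.pow i ⟨p • (y : G), y, rfl⟩
    obtain ⟨c, hc⟩ := hpC g
    refine ⟨p • c, Subtype.ext ?_⟩
    change p ^ i • (p • (c : G)) = p • (y : G)
    rw [hc]
    exact congrArg Subtype.val hg
  · refine Or.inr ⟨m + 1, fun x hx => ?_, ?_⟩
    · obtain ⟨y, rfl⟩ := hC x hx
      obtain ⟨⟨_, g, rfl⟩, hg⟩ := hm ⟨p • (y : G), y, rfl⟩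
        (Subtype.ext (show p • (p • (y : G)) = 0 from congrArg Subtype.val hx))
      obtain ⟨c, hc⟩ := hpC g
      refine ⟨c, Subtype.ext ?_⟩
      change p ^ (m + 1) • (c : G) = p • (y : G)
      rw [pow_succ, mul_smul, hc]
      exact congrArg Subtype.val hg
    · have hmem : ∀ x : heightSocle p (m + 1 + 1) C, ((x : C) : G) ∈ pMultiples p G := by
        rintro ⟨x, hx⟩
        obtain ⟨-, y, rfl⟩ := mem_heightSocle.mp hx
        refine mem_pMultiples.mpr ⟨p ^ (m + 1) • (y : G), ?_⟩
        rw [smul_smul, ← pow_succ']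
        rfl
      refine Finite.of_injective (α := heightSocle p (m + 1 + 1) C)
        (β := heightSocle p (m + 1) (pMultiples p G)) (fun x => ⟨⟨x, hmem x⟩, ?_⟩) ?_
      · obtain ⟨hpx, y, hy⟩ := mem_heightSocle.mp x.2
        refine mem_heightSocle.mpr ⟨Subtype.ext
          (show p • ((x : C) : G) = 0 from congrArg Subtype.val hpx), ⟨p • (y : G), y, rfl⟩, Subtype.ext ?_⟩
        change p ^ (m + 1) • (p • (y : G)) = _
        rw [smul_smul, ← pow_succ]
        exact congrArg Subtype.val hy
      · intro x y hxy
        have h := congrArg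
          (fun z : heightSocle p (m + 1) (pMultiples p G) => ((z : pMultiples p G) : G)) hxy
        exact Subtype.ext (Subtype.ext h)

theorem IsNearlyHomogeneous.isSemiGeneralizedCoBassian (hp : p.Prime) (hG : IsPPrimary p G)
    (h : IsNearlyHomogeneous p (pMultiples p G)) : IsSemiGeneralizedCoBassian G := by
  intro H φ hφ
  -- With j = 0 this removes a maximal elementary summand; the socle of the remaining G' has height
  -- at least 1, and pG' = pG.
  obtain ⟨κ, θ, G', hinj, hG', hsoc⟩ := exists_isCompl_homocyclic hp hG (j := 0)
    (fun x _ => ⟨x, by simp⟩)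
  have hpθ : ∀ t, p • θ t = 0 := fun t => by
    have : p ^ (0 + 1) • θ t = 0 := by
      rw [← map_nsmul, pow_nsmul_finsupp_cocyclicGroup, map_zero]
    simpa using this
  have hpG' : ∀ g : G, ∃ c : G', p • (c : G) = p • g := by
    intro g
    obtain ⟨_, ⟨t, rfl⟩, c, hc, rfl⟩ := AddSubgroup.mem_sup.mp
      (hG'.codisjoint.eq_top ▸ AddSubgroup.mem_top g)
    exact ⟨⟨c, hc⟩, by rw [smul_add, hpθ, zero_add]⟩
  have hN' : IsNearlyHomogeneous p G' := h.of_pMultiples hG (by simpa using hsoc) hpG'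
  have hq : Function.Surjective (QuotientAddGroup.mk' H) := QuotientAddGroup.mk'_surjective H
  have hX : IsPPrimary p (G ⧸ H) := hG.of_surjective _ hq
  let φ' : G' →+ G ⧸ H := φ.comp G'.subtype
  obtain ⟨C, hC, j, hj⟩ := hN'.exists_isCompl_range hp (hG.addSubgroup G') hX
    ((QuotientAddGroup.mk' H).comp G'.subtype) φ' (fun n x => by
      obtain ⟨g, rfl⟩ := hq x
      obtain ⟨c, hc⟩ := hpG' g
      refine ⟨c, ?_⟩
      change p ^ (n + 1) • QuotientAddGroup.mk' H (c : G) = _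
      rw [← map_nsmul, ← map_nsmul, pow_succ, mul_smul, hc, mul_smul])
    (hφ.comp G'.subtype_injective)
  have hle : φ'.range ≤ φ.range := by
    rintro _ ⟨c, rfl⟩
    exact ⟨c, rfl⟩
  -- Since pG = pG', multiplying φ(G) ∩ C by p lands in φ(G') ∩ C = 0.
  have hpN : ∀ x ∈ φ.range.addSubgroupOf C, p • x = 0 := by
    rintro ⟨x, hxC⟩ ⟨g, hg⟩
    obtain ⟨c, hc⟩ := hpG' g
    refine Subtype.ext (AddSubgroup.disjoint_def.mp hC.disjoint ⟨p • c, ?_⟩ (C.nsmul_mem hxC _))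
    change φ (p • (c : G)) = p • x
    rw [hc, map_nsmul, hg]
    rfl
  obtain ⟨S, ⟨S', hS⟩, hSN⟩ := isSocleOfSummand hp (hX.addSubgroup C) hj hpN
  refine ⟨_, ⟨_, isCompl_sup_map hC hS⟩, ?_, ?_⟩
  · rintro x ⟨g, rfl⟩
    obtain ⟨y, hy, c, hc, hyc⟩ := AddSubgroup.mem_sup.mp
      (hC.codisjoint.eq_top ▸ AddSubgroup.mem_top (φ g))
    have hcφ : c ∈ φ.range := by
      rw [eq_sub_of_add_eq' hyc]
      exact sub_mem ⟨g, rfl⟩ (hle hy)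
    rw [← hyc]
    exact AddSubgroup.add_mem_sup hy ⟨⟨c, hc⟩,
      ((hSN ⟨c, hc⟩).mp (AddSubgroup.mem_addSubgroupOf.mpr hcφ)).2, rfl⟩
  · intro Z hZ hZ0 hbot
    obtain ⟨⟨z, hz⟩, hz0⟩ := AddSubgroup.ne_bot_iff_exists_ne_zero.mp hZ0
    obtain ⟨r, hr, hr'⟩ := hX.exists_pow_ne_zero (x := z) (fun h => hz0 (Subtype.ext h))
    have hzr : p ^ r • z ∈ Z := Z.nsmul_mem hz _
    obtain ⟨y, hy, s, hs, hpy, hps, hys⟩ := mem_sup_map_socle hC (hZ hzr) hr'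
    have hmem : p ^ r • z ∈ φ.range ⊓ Z := by
      refine ⟨?_, hzr⟩
      rw [← hys]
      exact add_mem (hle hy) (AddSubgroup.mem_addSubgroupOf.mp ((hSN s).mpr ⟨hps, hs⟩))
    rw [hbot] at hmem
    exact hr hmem

theorem IsPPrimary.isGeneralizedCoBassian_iff (hp : p.Prime) (hG : IsPPrimary p G) :
    IsGeneralizedCoBassian G ↔ IsNearlyHomogeneous p G :=
  ⟨fun h => h.isNearlyHomogeneous hp hG, fun h => h.isGeneralizedCoBassian hp hG⟩

end Main

theorem theorem2 {G : Type*} [AddCommGroup G] (p : ℕ) (hp : p.Prime)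
    (hG : IsPGroup p (Multiplicative G)) :
    (IsSemiGeneralizedCoBassian G ↔ IsGeneralizedCoBassian (pMultiples p G)) ∧
      (IsGeneralizedCoBassian (pMultiples p G) ↔
        HasGeneralizedFinitePRank p (pMultiples p G)) := by
  have hG' : IsPPrimary p G := fun x => by
    obtain ⟨n, hn⟩ := hG (Multiplicative.ofAdd x)
    exact ⟨n, by rw [← ofAdd_nsmul] at hn; exact ofAdd_eq_one.mp hn⟩
  have hpG : IsPPrimary p (pMultiples p G) := hG'.addSubgroup _
  rw [hpG.isGeneralizedCoBassian_iff hp]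
  exact ⟨⟨fun h => h.isNearlyHomogeneous hp hG', fun h => h.isSemiGeneralizedCoBassian hp hG'⟩,
    ⟨fun h => h.hasGeneralizedFinitePRank hp hpG, fun h => h.isNearlyHomogeneous hp⟩⟩
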